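/- **Theorem 1.** Let $\mathbb G$ be a compact Lie group with normalized Haar measure $dg$, and let $\mathbb C^d$ be a finite-dimensional quantum system; superoperators are linear maps on the space $\mathcal L(\mathbb C^d)$ of $d\times d$ complex matrices. Let the reference implementation $\omega$ be a continuous representation of $\mathbb G$ on $\mathcal L(\mathbb C^d)$ by quantum channels (completely positive, trace-preserving maps), with decomposition $\omega\cong\bigoplus_{\lambda\in\Lambda}\sigma_\lambda^{\oplus n_\lambda}$, where $\Lambda$ is finite and the $\sigma_\lambda$ are pairwise inequivalent complex irreducible representations of $\mathbb G$. Let the noisy implementation $\phi$ be a measurable map assigning to every $g\in\mathbb G$ a quantum operation $\phi(g)$ on $\mathcal L(\mathbb C^d)$ (a completely positive, trace non-increasing map; in particular any quantum channel is allowed). The diamond norm of a superoperator $\mathcal C$ is $$\|\mathcal C\|_\diamond=\sup_{R,\,|\psi\rangle}\big\|(\mathcal C\otimes\mathrm{id}_R)(|\psi\rangle\langle\psi|)\big\|_1,$$ the supremum being over all finite-dimensional reference systems $R$ and all unit vectors $|\psi\rangle\in\mathbb C^d\otimes R$. For a state $\rho$, a POVM $\{\Pi_i\}_i$ (the state and measurement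 actually realized, i.e. including preparation and measurement errors), an ending gate $g_{\mathrm{end}}\in\mathbb G$ and a sequence length $m$, the output probability of the randomized benchmarking experiment is $$p(i,m)=\int_{\mathbb G^m}\operatorname{Tr}\!\Big[\Pi_i\;\phi\big(g_{\mathrm{end}}(g_m\cdots g_2g_1)^{-1}\big)\circ\phi(g_m)\circ\cdots\circ\phi(g_1)\,(\rho)\Big]\,dg_1\cdots dg_m .$$ Then there are complex $n_\lambda\times n_\lambda$ matrices $M_\lambda$ ($\lambda\in\Lambda$), which for the given $\mathbb G$ and $\omega$ (with its decomposition) depend only on the implementation $\phi$, such that the following holds. Whenever $\delta>0$ satisfies $$\int_{\mathbb G}\|\omega(g)-\phi(g)\|_\diamond\,dg\le\delta<\frac19,$$ then for all $g_{\mathrm{end}}$, $\rho$, $\{\Pi_i\}_i$ and every outcome $i$ there are complex $n_\lambda\times n_\lambda$ matrices $A_\lambda$ ($\lambda\in\Lambda$), independent of $m$, such that for every sequence length $m\ge1$ $$\Big|\,p(i,m)-\sum_{\lambda\in\Lambda}\operatorname{Tr}\big(A_\lambda M_\lambda^{\,m}\big)\Big|\le\frac{16}{1-9\delta}\left[\delta\left(2+\frac{4\delta}{1-5\delta}\right)\right]^m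 .$$ -/

import Mathlib

open MeasureTheory
open scoped Manifold ContDiff ComplexOrder

noncomputable section

namespace RandomizedBenchmarking

/-- Superoperators: linear maps on the space of operators of a `d`-dimensional quantum system.
Multiplication in this ring is composition. -/
abbrev SuperOp (d : ℕ) : Type := Module.End ℂ (Matrix (Fin d) (Fin d) ℂ)

/-- `tensorId C r X = (C ⊗ id_R)(X)` for a reference system `R` of dimension `r`. -/
def tensorId {d : ℕ} (C : SuperOp d) (r : ℕ) (X : Matrix (Fin d × Fin r) (Fin d × Fin r) ℂ) :
    Matrix (Fin d × Fin r) (Fin d × Fin r) ℂ :=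
  Matrix.of fun p q => C (Matrix.of fun i j => X (i, p.2) (j, q.2)) p.1 q.1

/-- The trace norm `‖X‖₁ = Tr √(Xᴴ X)`: the sum of the square roots of the eigenvalues of `Xᴴ X`,
that is, the sum of the singular values of `X`. -/
def traceNorm {ι : Type*} [Fintype ι] [DecidableEq ι] (X : Matrix ι ι ℂ) : ℝ :=
  ∑ i, Real.sqrt ((Matrix.isHermitian_conjTranspose_mul_self X).eigenvalues i)

/-- The rank-one operator `|ψ⟩⟨ψ|`. -/
def ketBra {ι : Type*} [Fintype ι] (ψ : EuclideanSpace ℂ ι) : Matrix ι ι ℂ :=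
  Matrix.of fun i j => ψ i * star (ψ j)

/-- The diamond norm: the supremum of `‖(C ⊗ id_R)(|ψ⟩⟨ψ|)‖₁` over all finite-dimensional reference
systems `R` and all normalized pure states `ψ` of the joint system. -/
def diamondNorm {d : ℕ} (C : SuperOp d) : ℝ :=
  sSup {x : ℝ | ∃ (r : ℕ) (ψ : EuclideanSpace ℂ (Fin d × Fin r)),
    ‖ψ‖ = 1 ∧ x = traceNorm (tensorId C r (ketBra ψ))}

/-- Complete positivity: `C ⊗ id_R` preserves positive semidefinite operators for every `R`. -/
def IsCompletelyPositive {d : ℕ} (C : SuperOp d) : Prop :=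
  ∀ (r : ℕ) (X : Matrix (Fin d × Fin r) (Fin d × Fin r) ℂ),
    X.PosSemidef → (tensorId C r X).PosSemidef

/-- Quantum operations: completely positive, trace non-increasing maps. -/
def IsQuantumOperation {d : ℕ} (C : SuperOp d) : Prop :=
  IsCompletelyPositive C ∧
    ∀ X : Matrix (Fin d) (Fin d) ℂ, X.PosSemidef → (C X).trace.re ≤ X.trace.re

/-- Quantum channels: completely positive, trace preserving maps. -/
def IsQuantumChannel {d : ℕ} (C : SuperOp d) : Prop :=
  IsCompletelyPositive C ∧ ∀ X : Matrix (Fin d) (Fin d) ℂ, (C X).trace = X.trace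

/-- Quantum states: density matrices. -/
def IsState {d : ℕ} (ρ : Matrix (Fin d) (Fin d) ℂ) : Prop :=
  ρ.PosSemidef ∧ ρ.trace = 1

/-- Positive operator valued measures with `k` outcomes. -/
def IsPOVM {d k : ℕ} (P : Fin k → Matrix (Fin d) (Fin d) ℂ) : Prop :=
  (∀ i, (P i).PosSemidef) ∧ ∑ i, P i = 1

variable {G : Type*} [Group G]

/-- The inverse `(g_m ⋯ g_2 g_1)⁻¹` of a gate sequence `g_1, …, g_m`
(the entry `g 0` is the gate `g_1`, which is applied first). -/
def inversionGate {m : ℕ} (g : Fin m → G) : G :=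
  ((List.ofFn g).reverse.prod)⁻¹

/-- The noisy operation `φ(g_m) ∘ ⋯ ∘ φ(g_1)` applied by a gate sequence. -/
def sequenceOp {d m : ℕ} (φ : G → SuperOp d) (g : Fin m → G) : SuperOp d :=
  (List.ofFn fun j => φ (g j)).reverse.prod

/-- The probability `Tr [E φ(g_end g_inv) φ(g_m) ⋯ φ(g_1) ρ]` of the outcome with effect `E`, given
the gate sequence `g_1, …, g_m`. -/
def conditionalProb {d m : ℕ} (φ : G → SuperOp d) (gEnd : G) (ρ E : Matrix (Fin d) (Fin d) ℂ)
    (g : Fin m → G) : ℝ :=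
  (E * φ (gEnd * inversionGate g) (sequenceOp φ g ρ)).trace.re

/-- The output probability `p(i,m)` for the effect `E = Π_i`: the average of the conditional
probability over independent gates `g_1, …, g_m`, each with law `μ`. -/
def outputProb {d : ℕ} [MeasurableSpace G] (μ : Measure G) [SigmaFinite μ] (φ : G → SuperOp d)
    (gEnd : G) (ρ E : Matrix (Fin d) (Fin d) ℂ) (m : ℕ) : ℝ :=
  ∫ g : Fin m → G, conditionalProb φ gEnd ρ E g ∂(Measure.pi fun _ => μ)

end RandomizedBenchmarking

end

namespace RandomizedBenchmarking

/-! ### Perturbation of an idempotent in a Banach ring -/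

section Perturbation

/-! The randomized sequence is a power of a single operator. In the Heisenberg picture let `p g` be
precomposition of functionals with `φ g`, and let `a` be the convolution `F ↦ ∫ p(g) F(x g⁻¹) dg` on
bounded measurable functions from `G` to functionals. Unrolling `a ^ m` and evaluating at `gEnd` and
`ρ`, with `F x = Tr (E φ(x) ·)`, gives exactly `p(i,m)` (`convolution_pow_apply`,
`ofReal_outputProb`). Bounded functions are used, not classes modulo null sets, because the value at
one gate `gEnd` is needed.

For the reference representation, with Heisenberg maps `w g`, the same convolution is an idempotent
`P = J V` of norm at most one. Its range is the space of equivariant functions `x ↦ w(x) f`, a copy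
of the space of functionals. The average diamond distance bounds `‖a - P‖`.

Below the threshold `1/9`, `a` has an invariant subspace that is the graph of a small `X` over the
range of `P`; `X` is found by contraction from a Riccati equation. A Sylvester equation then splits
off the complement, on which powers of `a` decay at the rate `δ (2 + riccatiBound δ)`
(`exists_pow_decomposition`). What remains are the powers of an operator `t` on functionals.

Left translations commute with both `a` and `P`, hence with `X` by uniqueness of the small Riccati
solution, so `t` commutes with every `w g`. Undoing the duality, Schur's lemma turns `t` into blocks
`M l` acting on multiplicity spaces, and every linear form of `t ^ m` is a sum of traces `(A l * M l
^ m).trace` (`exists_matrix_powers_of_commute`). -/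

theorem exists_fixedPoint_of_norm_le {E : Type*} [NormedAddCommGroup E] [CompleteSpace E]
    (T : E → E) {r K : ℝ} (hr : 0 ≤ r) (hK : 0 ≤ K) (hK1 : K < 1)
    (hmaps : ∀ x, ‖x‖ ≤ r → ‖T x‖ ≤ r)
    (hlip : ∀ x y, ‖x‖ ≤ r → ‖y‖ ≤ r → ‖T x - T y‖ ≤ K * ‖x - y‖) :
    ∃ x, ‖x‖ ≤ r ∧ T x = x := by
  have hsf : Set.MapsTo T (Metric.closedBall 0 r) (Metric.closedBall 0 r) := fun x hx => by
    simpa using hmaps x (by simpa using hx)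
  have hc : ContractingWith ⟨K, hK⟩ (hsf.restrict T _ _) := by
    refine ⟨by exact_mod_cast hK1, LipschitzWith.of_dist_le_mul fun x y => ?_⟩
    have := hlip x y (mem_closedBall_zero_iff.1 x.2) (mem_closedBall_zero_iff.1 y.2)
    rw [Subtype.dist_eq, Subtype.dist_eq, dist_eq_norm, dist_eq_norm]
    exact this
  obtain ⟨y, hy, hfix, -⟩ := ContractingWith.exists_fixedPoint'
    (Metric.isClosed_closedBall.isComplete) hsf hc (x := (0 : E)) (by simpa using hr)
    (edist_ne_top _ _)
  exact ⟨y, by simpa using hy, hfix⟩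

variable {A : Type*} [NormedRing A]

/-- `X` parametrizes the invariant subspace `{v + X v | v ∈ range P}` of `a`: it solves the
Riccati equation for the perturbation `a` of the idempotent `P`. -/
def IsRiccatiSolution (P a X : A) : Prop := (1 - P - X) * (a - P) * (P + X) = X

/-- A bound for the solution of the Riccati equation. -/
noncomputable def riccatiBound (δ : ℝ) : ℝ := 4 * δ / (1 - 5 * δ)

theorem riccatiBound_nonneg {δ : ℝ} (h0 : 0 ≤ δ) (h1 : δ < 1 / 9) : 0 ≤ riccatiBound δ :=
  div_nonneg (by linarith) (by linarith)

/-- The threshold `1/9` is exactly where `4δ / (1 - 5δ)` reaches `1`. -/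
theorem riccatiBound_le_one {δ : ℝ} (h1 : δ < 1 / 9) : riccatiBound δ ≤ 1 := by
  rw [riccatiBound, div_le_one (by linarith)]; linarith

theorem riccatiBound_mono {δ ε : ℝ} (h : δ ≤ ε) (h1 : ε < 1 / 9) :
    riccatiBound δ ≤ riccatiBound ε := by
  rw [riccatiBound, riccatiBound, div_le_div_iff₀ (by linarith) (by linarith)]
  nlinarith

/-- This makes the Riccati map preserve the ball of radius `riccatiBound δ`. After clearing
denominators it follows from `6δ² + 12δ ≤ 2`, so there is slack. -/
theorem riccatiBound_spec {δ : ℝ} (h0 : 0 ≤ δ) (h1 : δ < 1 / 9) :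
    (2 + riccatiBound δ) * δ * (1 + riccatiBound δ) ≤ riccatiBound δ := by
  have h5 : 0 < 1 - 5 * δ := by linarith
  have e1 : 2 + riccatiBound δ = (2 - 6 * δ) / (1 - 5 * δ) := by
    rw [riccatiBound, eq_div_iff h5.ne', add_mul, div_mul_cancel₀ _ h5.ne']; ring
  have e2 : 1 + riccatiBound δ = (1 - δ) / (1 - 5 * δ) := by
    rw [riccatiBound, eq_div_iff h5.ne', add_mul, div_mul_cancel₀ _ h5.ne']; ring
  rw [e1, e2, riccatiBound]
  rw [div_mul_eq_mul_div, div_mul_div_comm, div_le_div_iff₀ (by positivity) h5]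
  have h3 : (2 - 6 * δ) * (1 - δ) ≤ 4 * (1 - 5 * δ) := by nlinarith
  have := mul_le_mul_of_nonneg_left h3 (mul_nonneg h0 h5.le)
  nlinarith

variable {P a : A} {δ : ℝ}

theorem norm_mul_mul_le {u v w : A} {α β γ : ℝ} (hu : ‖u‖ ≤ α) (hv : ‖v‖ ≤ β) (hw : ‖w‖ ≤ γ) :
    ‖u * v * w‖ ≤ α * β * γ :=
  (norm_mul_le _ _).trans (mul_le_mul ((norm_mul_le _ _).trans (mul_le_mul hu hv (norm_nonneg _)
    ((norm_nonneg _).trans hu))) hw (norm_nonneg _)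
    (mul_nonneg ((norm_nonneg _).trans hu) ((norm_nonneg _).trans hv)))

/-- On a ball of radius at most `1` the Lipschitz constant is at most `5δ < 1`, which yields both
existence and uniqueness of the small solution. -/
theorem riccati_lipschitz (hP : ‖P‖ ≤ 1) (hQ : ‖1 - P‖ ≤ 2)
    (ha : ‖a - P‖ ≤ δ) {X Y : A} {x : ℝ} (hX : ‖X‖ ≤ x) (hY : ‖Y‖ ≤ x) :
    ‖(1 - P - X) * (a - P) * (P + X) - (1 - P - Y) * (a - P) * (P + Y)‖
      ≤ δ * (3 + 2 * x) * ‖X - Y‖ := by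
  have e : (1 - P - X) * (a - P) * (P + X) - (1 - P - Y) * (a - P) * (P + Y) =
      (1 - P - X) * (a - P) * (X - Y) - (X - Y) * (a - P) * (P + Y) := by noncomm_ring
  rw [e]
  refine (norm_sub_le _ _).trans ((add_le_add
    (norm_mul_mul_le ((norm_sub_le _ _).trans (add_le_add hQ hX)) ha le_rfl)
    (norm_mul_mul_le le_rfl ha ((norm_add_le _ _).trans (add_le_add hP hY)))).trans (le_of_eq ?_))
  ring

theorem exists_isRiccatiSolution [CompleteSpace A] (hP : ‖P‖ ≤ 1) (hQ : ‖1 - P‖ ≤ 2)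
    (h0 : 0 ≤ δ) (h1 : δ < 1 / 9) (ha : ‖a - P‖ ≤ δ) :
    ∃ X, ‖X‖ ≤ riccatiBound δ ∧ IsRiccatiSolution P a X := by
  have hx0 := riccatiBound_nonneg h0 h1
  have hx1 := riccatiBound_le_one h1
  refine exists_fixedPoint_of_norm_le (fun X => (1 - P - X) * (a - P) * (P + X))
    (K := δ * (3 + 2 * riccatiBound δ)) hx0 (by positivity) (by nlinarith) (fun X hX => ?_)
    fun X Y hX hY => riccati_lipschitz hP hQ ha hX hY
  exact (norm_mul_mul_le ((norm_sub_le _ _).trans (add_le_add hQ hX)) ha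
    ((norm_add_le _ _).trans (add_le_add hP hX))).trans (riccatiBound_spec h0 h1)

theorem eq_of_norm_sub_le {E : Type*} [NormedAddCommGroup E] {x y : E} {K : ℝ} (hK : K < 1)
    (h : ‖x - y‖ ≤ K * ‖x - y‖) : x = y := by
  rw [← sub_eq_zero, ← norm_le_zero_iff]
  nlinarith [norm_nonneg (x - y)]

theorem IsRiccatiSolution.unique (hP : ‖P‖ ≤ 1) (hQ : ‖1 - P‖ ≤ 2)
    (h0 : 0 ≤ δ) (h1 : δ < 1 / 9) (ha : ‖a - P‖ ≤ δ) {X Y : A}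
    (hX : IsRiccatiSolution P a X) (hY : IsRiccatiSolution P a Y)
    (hXn : ‖X‖ ≤ riccatiBound δ) (hYn : ‖Y‖ ≤ riccatiBound δ) : X = Y := by
  have hx1 := riccatiBound_le_one h1
  refine eq_of_norm_sub_le (K := δ * (3 + 2 * riccatiBound δ)) (by nlinarith) ?_
  have := riccati_lipschitz hP hQ ha hXn hYn
  rwa [hX, hY] at this

/-- Multiplying the Riccati equation by `P` gives a linear homogeneous equation for `P * X` whose
coefficient has norm below one, so only zero solves it. With `mul_right` this makes `P + X` an
idempotent with the same kernel as `P`. -/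
theorem IsRiccatiSolution.mul_left (hPP : P * P = P) (hP : ‖P‖ ≤ 1)
    (h0 : 0 ≤ δ) (h1 : δ < 1 / 9) (ha : ‖a - P‖ ≤ δ) {X : A}
    (hX : IsRiccatiSolution P a X) (hXn : ‖X‖ ≤ riccatiBound δ) : P * X = 0 := by
  have hx1 := riccatiBound_le_one h1
  have e : P * X = -(P * X) * (a - P) * (P + X) := by
    conv_lhs => rw [← hX]
    calc P * ((1 - P - X) * (a - P) * (P + X))
        = (P - P * P - P * X) * (a - P) * (P + X) := by noncomm_ring
      _ = _ := by rw [hPP]; noncomm_ring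
  refine eq_of_norm_sub_le (K := δ * (1 + riccatiBound δ)) (by nlinarith) ?_
  rw [sub_zero]
  conv_lhs => rw [e]
  refine (norm_mul_mul_le le_rfl ha ((norm_add_le _ _).trans (add_le_add hP hXn))).trans
    (le_of_eq ?_)
  rw [norm_neg]; ring

theorem IsRiccatiSolution.mul_right (hPP : P * P = P) (hQ : ‖1 - P‖ ≤ 2)
    (h0 : 0 ≤ δ) (h1 : δ < 1 / 9) (ha : ‖a - P‖ ≤ δ) {X : A}
    (hX : IsRiccatiSolution P a X) (hXn : ‖X‖ ≤ riccatiBound δ) : X * P = X := by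
  have hx1 := riccatiBound_le_one h1
  have e : X - X * P = (1 - P - X) * (a - P) * (X - X * P) := by
    have : X * (1 - P) = (1 - P - X) * (a - P) * (P + X) * (1 - P) := by rw [hX]
    calc X - X * P = X * (1 - P) := by noncomm_ring
      _ = (1 - P - X) * (a - P) * (P + X) * (1 - P) := this
      _ = (1 - P - X) * (a - P) * (P - P * P + (X - X * P)) := by noncomm_ring
      _ = _ := by rw [hPP, sub_self, zero_add]
  refine (eq_of_norm_sub_le (K := (2 + riccatiBound δ) * δ) (by nlinarith) ?_).symm
  conv_lhs => rw [e]
  exact norm_mul_mul_le ((norm_sub_le _ _).trans (add_le_add hQ hXn)) ha le_rfl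

/-- The compression of `a` to the invariant subspace given by `X`. -/
def compression (P a X : A) : A := P + P * (a - P) * (P + X)

/-- The form `P * _ * P` lets the compression factor through the range of `P`, that is, through the
space of functionals once `P = J V`. -/
theorem IsRiccatiSolution.compression_eq (hPP : P * P = P) (hP : ‖P‖ ≤ 1) (hQ : ‖1 - P‖ ≤ 2)
    (h0 : 0 ≤ δ) (h1 : δ < 1 / 9) (ha : ‖a - P‖ ≤ δ) {X : A}
    (hX : IsRiccatiSolution P a X) (hXn : ‖X‖ ≤ riccatiBound δ) :
    compression P a X = P * (a * (P + X)) * P := by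
  have hPX := hX.mul_left hPP hP h0 h1 ha hXn
  have hXP := hX.mul_right hPP hQ h0 h1 ha hXn
  have hZP : (P + X) * P = P + X := by rw [add_mul, hPP, hXP]
  have hPPZ : P * P * (P + X) = P := by rw [hPP, mul_add, hPP, hPX, add_zero]
  calc compression P a X = P * P * (P + X) + P * (a - P) * (P + X) := by rw [hPPZ]; rfl
    _ = P * a * (P + X) := by noncomm_ring
    _ = P * (a * (P + X)) * P := by
      rw [mul_assoc P (a * (P + X)), mul_assoc a, hZP, mul_assoc]

/-- Conjugating `X` by a symmetry `S` of both `P` and `a` gives another solution in the same ball,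
so uniqueness forces `S X S⁻¹ = X`. -/
theorem IsRiccatiSolution.commute (hP : ‖P‖ ≤ 1) (hQ : ‖1 - P‖ ≤ 2)
    (h0 : 0 ≤ δ) (h1 : δ < 1 / 9) (ha : ‖a - P‖ ≤ δ) {X : A}
    (hX : IsRiccatiSolution P a X) (hXn : ‖X‖ ≤ riccatiBound δ) {S T : A} (hST : S * T = 1)
    (hTS : T * S = 1) (hS : ‖S‖ ≤ 1) (hT : ‖T‖ ≤ 1) (hSP : Commute S P) (hSa : Commute S a) :
    Commute S X := by
  have e0 : ∀ Y, Commute S Y → S * Y * T = Y := fun Y h => by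
    rw [h.eq, mul_assoc, hST, mul_one]
  have hconj : IsRiccatiSolution P a (S * X * T) := by
    have f1 : 1 - P - S * X * T = S * (1 - P - X) * T := by
      conv_lhs => rw [← e0 P hSP, ← e0 1 (Commute.one_right S)]
      noncomm_ring
    have f2 : P + S * X * T = S * (P + X) * T := by
      conv_lhs => rw [← e0 P hSP]
      noncomm_ring
    have f3 : a - P = S * (a - P) * T := (e0 _ (hSa.sub_right hSP)).symm
    unfold IsRiccatiSolution
    rw [f1, f2]
    nth_rewrite 1 [f3]
    conv_rhs => rw [← hX]
    calc S * (1 - P - X) * T * (S * (a - P) * T) * (S * (P + X) * T)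
        = S * (1 - P - X) * (T * S) * (a - P) * (T * S) * (P + X) * T := by noncomm_ring
      _ = _ := by rw [hTS]; noncomm_ring
  have hn : ‖S * X * T‖ ≤ riccatiBound δ :=
    (norm_mul_mul_le hS hXn hT).trans (by simp)
  have h := hconj.unique hP hQ h0 h1 ha hX hn hXn
  calc S * X = S * X * (T * S) := by rw [hTS, mul_one]
    _ = S * X * T * S := by rw [mul_assoc, mul_assoc, mul_assoc]
    _ = X * S := by rw [h]

/-- Powers of a perturbation `a` of an idempotent `P`: up to an exponentially small remainder they
are governed by the powers of the compression of `a` to a perturbed invariant subspace. -/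
theorem exists_pow_decomposition [CompleteSpace A] (hPP : P * P = P) (hP : ‖P‖ ≤ 1)
    (hQ : ‖1 - P‖ ≤ 2) (h0 : 0 ≤ δ) (h1 : δ < 1 / 9) (ha : ‖a - P‖ ≤ δ) {X : A}
    (hX : IsRiccatiSolution P a X) (hXn : ‖X‖ ≤ riccatiBound δ) :
    ∃ U : A, ∀ m : ℕ, ‖a ^ m - (P + X) * compression P a X ^ m * U‖
      ≤ 9 / 2 * (δ * (2 + riccatiBound δ)) ^ m := by
  have hx0 := riccatiBound_nonneg h0 h1
  have hx1 := riccatiBound_le_one h1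
  set x := riccatiBound δ with hx
  have hPX := hX.mul_left hPP hP h0 h1 ha hXn
  have hXP := hX.mul_right hPP hQ h0 h1 ha hXn
  set E := a - P with hE
  set Z := P + X with hZ
  set Y := 1 - P - X with hY
  set M := compression P a X with hM
  have haE : a = P + E := by rw [hE]; abel
  have hYEZ : Y * E * Z = X := hX
  have hZn : ‖Z‖ ≤ 1 + x := (norm_add_le _ _).trans (add_le_add hP hXn)
  have hYn : ‖Y‖ ≤ 2 + x := (norm_sub_le _ _).trans (add_le_add hQ hXn)
  have hZY : Z + Y = 1 := by rw [hZ, hY]; abel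
  have hMd : M = P + P * E * Z := rfl
  have hYEn : ‖Y * E‖ ≤ δ * (2 + x) := by
    refine (norm_mul_le _ _).trans ((mul_le_mul hYn ha (norm_nonneg _) (by linarith)).trans
      (le_of_eq (by ring)))
  have hPEn : ‖P * E‖ ≤ δ := by
    refine (norm_mul_le _ _).trans ((mul_le_mul hP ha (norm_nonneg _) (by linarith)).trans
      (le_of_eq (by ring)))
  have hPEZn : ‖P * E * Z‖ ≤ δ * (1 + x) :=
    (norm_mul_le _ _).trans (mul_le_mul hPEn hZn (norm_nonneg _) h0)
  -- `W` solves the Sylvester equation `M W = P E + W (Y E)`, which removes the remaining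
  -- off-diagonal block. The radius `1/4` works because `δ + δ (3 + 2x) / 4 ≤ 9δ/4 < 1/4`.
  obtain ⟨W, hWn, hW⟩ := exists_fixedPoint_of_norm_le (r := 1 / 4)
    (fun W : A => P * E + W * (Y * E) - P * E * Z * W) (K := δ * (3 + 2 * x)) (by norm_num)
    (by positivity) (by nlinarith)
    (fun W hW => by
      have e1 : ‖W * (Y * E)‖ ≤ 1 / 4 * (δ * (2 + x)) :=
        (norm_mul_le _ _).trans (mul_le_mul hW hYEn (norm_nonneg _) (by norm_num))
      have e2 : ‖P * E * Z * W‖ ≤ δ * (1 + x) * (1 / 4) :=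
        (norm_mul_le _ _).trans (mul_le_mul hPEZn hW (norm_nonneg _) (by positivity))
      refine (norm_sub_le _ _).trans ((add_le_add ((norm_add_le _ _).trans
        (add_le_add hPEn e1)) e2).trans ?_)
      nlinarith)
    (fun V W _ _ => by
      have e : P * E + V * (Y * E) - P * E * Z * V - (P * E + W * (Y * E) - P * E * Z * W)
        = (V - W) * (Y * E) - P * E * Z * (V - W) := by noncomm_ring
      rw [e]
      refine (norm_sub_le _ _).trans ((add_le_add (norm_mul_le _ _) (norm_mul_le _ _)).trans ?_)
      have := norm_nonneg (V - W)
      nlinarith)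
  have hPW : P * W = W := by
    have e : W - P * W = (W - P * W) * (Y * E) := by
      have : (1 - P) * (P * E + W * (Y * E) - P * E * Z * W) = (1 - P) * W := by rw [hW]
      calc W - P * W = (1 - P) * W := by noncomm_ring
        _ = (P - P * P) * E + (W - P * W) * (Y * E) - (P - P * P) * E * Z * W := by
            rw [← this]; noncomm_ring
        _ = _ := by rw [hPP]; noncomm_ring
    refine (eq_of_norm_sub_le (K := δ * (2 + x)) (by nlinarith) ?_).symm
    conv_lhs => rw [e]
    exact (norm_mul_le _ _).trans
      ((mul_le_mul_of_nonneg_left hYEn (norm_nonneg _)).trans (le_of_eq (mul_comm _ _)))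
  have hMW : M * W = P * E + W * (Y * E) := by
    rw [hMd, add_mul, hPW]
    nth_rewrite 1 [← hW]
    noncomm_ring
  have hYP : Y * P = -X := by
    rw [hY, sub_mul, sub_mul, one_mul, hPP, hXP]; abel
  -- Since `Y P = -X`, the Riccati equation says `Y a Z = 0`: the range of `Z` is invariant, and `Y
  -- E` drives the quotient dynamics.
  have hYa : Y * a = Y * E * Y := by
    have : Y * E = Y * E * Z + Y * E * Y := by rw [← mul_add, hZY, mul_one]
    rw [haE, mul_add, hYP]
    nth_rewrite 1 [this]
    rw [hYEZ]; abel
  have hMP : M * P = M := by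
    have hZP : Z * P = Z := by rw [hZ, add_mul, hPP, hXP]
    rw [hMd, add_mul, hPP, mul_assoc, hZP]
  have hPa : P * a = M * P + P * E * Y := by
    have : P * E = P * E * Z + P * E * Y := by rw [← mul_add, hZY, mul_one]
    rw [hMP, hMd, haE, mul_add, hPP]
    nth_rewrite 1 [this]
    abel
  have hUa : (P + W * Y) * a = M * (P + W * Y) := by
    rw [add_mul, hPa, mul_assoc W, hYa, mul_add, ← mul_assoc M W, hMW]
    noncomm_ring
  -- Write `a ^ m = Z P a ^ m + Y a ^ m` and `P = (P + W Y) - W Y`; the term intertwined with `M`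
  -- splits off and every remaining term contains `Y a ^ m = (Y E) ^ m Y`.
  have hpow : ∀ m : ℕ, a ^ m - Z * M ^ m * (P + W * Y)
      = (Y * E) ^ m * Y - Z * (W * ((Y * E) ^ m * Y)) := by
    intro m
    have hY' : ∀ m : ℕ, Y * a ^ m = (Y * E) ^ m * Y := by
      intro m
      induction m with
      | zero => simp
      | succ m ih =>
        rw [pow_succ' a, ← mul_assoc, hYa, mul_assoc (Y * E), ih, pow_succ']
        noncomm_ring
    have hU' : ∀ m : ℕ, (P + W * Y) * a ^ m = M ^ m * (P + W * Y) := by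
      intro m
      induction m with
      | zero => simp
      | succ m ih => rw [pow_succ' a, ← mul_assoc, hUa, mul_assoc M, ih, pow_succ', mul_assoc]
    have hXPa : Z * P = Z := by rw [hZ, add_mul, hPP, hXP]
    have : a ^ m = Z * (P * a ^ m) + Y * a ^ m := by
      rw [← mul_assoc, hXPa, ← add_mul, hZY, one_mul]
    rw [mul_assoc Z, ← hU', ← hY']
    nth_rewrite 1 [this]
    noncomm_ring
  refine ⟨P + W * Y, fun m => ?_⟩
  rw [hpow]
  have hr0 : 0 ≤ δ * (2 + x) := by positivity
  have hYm : ‖(Y * E) ^ m * Y‖ ≤ (δ * (2 + x)) ^ m * (2 + x) := by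
    have : ∀ m : ℕ, ‖(Y * E) ^ m * Y‖ ≤ (δ * (2 + x)) ^ m * (2 + x) := by
      intro m
      induction m with
      | zero => simpa using hYn
      | succ m ih =>
        rw [pow_succ', mul_assoc (Y * E), pow_succ', mul_assoc (δ * (2 + x))]
        exact (norm_mul_le _ _).trans (mul_le_mul hYEn ih (norm_nonneg _) hr0)
    exact this m
  have hZW : ‖Z * (W * ((Y * E) ^ m * Y))‖ ≤ (1 + x) * (1 / 4 * ((δ * (2 + x)) ^ m * (2 + x))) :=
    (norm_mul_le _ _).trans (mul_le_mul hZn ((norm_mul_le _ _).trans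
      (mul_le_mul hWn hYm (norm_nonneg _) (by norm_num))) (norm_nonneg _) (by linarith))
  -- The constant is `(2 + x) + (1 + x)(2 + x)/4 ≤ 3 + 6/4 = 9/2` for `x ≤ 1`.
  refine (norm_sub_le _ _).trans ((add_le_add hYm hZW).trans ?_)
  have hp : 0 ≤ (δ * (2 + x)) ^ m := pow_nonneg hr0 m
  nlinarith [mul_nonneg hp hx0, mul_le_mul_of_nonneg_left hx1 hp,
    mul_le_mul_of_nonneg_left (mul_le_one₀ hx1 hx0 hx1) hp]

end Perturbation

/-! ### The commutant of a decomposed representation -/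

section Commutant

open DirectSum

variable {G W L : Type*} [Group G] [AddCommGroup W] [Module ℂ W]
  {ρ : Representation ℂ G W} {V : L → Type*}
  [∀ l, AddCommGroup (V l)] [∀ l, Module ℂ (V l)] {σ : ∀ l, Representation ℂ G (V l)}
  {n : L → ℕ} (e : ρ.Equiv (Representation.directSum fun p : (l : L) × Fin (n l) => σ p.1))

open scoped Classical in
/-- The inclusion of a summand of a decomposed representation. -/
noncomputable def summandIncl (p : (l : L) × Fin (n l)) : V p.1 →ₗ[ℂ] W :=
  e.toLinearEquiv.symm.toLinearMap ∘ₗ lof ℂ ((l : L) × Fin (n l)) (fun p => V p.1) p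

/-- The projection onto a summand of a decomposed representation. -/
noncomputable def summandProj (p : (l : L) × Fin (n l)) : W →ₗ[ℂ] V p.1 :=
  component ℂ ((l : L) × Fin (n l)) (fun p => V p.1) p ∘ₗ e.toLinearEquiv.toLinearMap

theorem summandProj_incl (p : (l : L) × Fin (n l)) (x : V p.1) :
    summandProj e p (summandIncl e p x) = x := by
  change component ℂ ((l : L) × Fin (n l)) (fun p => V p.1) p
    (e.toLinearEquiv (e.toLinearEquiv.symm _)) = x
  rw [LinearEquiv.apply_symm_apply, component.lof_self]

theorem summandProj_incl_of_ne {p q : (l : L) × Fin (n l)} (h : q ≠ p) (x : V q.1) :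
    summandProj e p (summandIncl e q x) = 0 := by
  change component ℂ ((l : L) × Fin (n l)) (fun p => V p.1) p
    (e.toLinearEquiv (e.toLinearEquiv.symm _)) = 0
  rw [LinearEquiv.apply_symm_apply, component.of, dif_neg h]

theorem summandProj_equivariant (p : (l : L) × Fin (n l)) (g : G) (x : W) :
    summandProj e p (ρ g x) = σ p.1 g (summandProj e p x) := by
  have h : e.toLinearEquiv (ρ g x) = Representation.directSum (fun p : (l : L) × Fin (n l) => σ p.1)
      g (e.toLinearEquiv x) :=
    Representation.IntertwiningMap.isIntertwining _ _ e.toIntertwiningMap g x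
  change component ℂ ((l : L) × Fin (n l)) (fun p => V p.1) p (e.toLinearEquiv (ρ g x)) = _
  rw [h]
  rfl

theorem summandIncl_equivariant (p : (l : L) × Fin (n l)) (g : G) (x : V p.1) :
    summandIncl e p (σ p.1 g x) = ρ g (summandIncl e p x) := by
  classical
  apply e.toLinearEquiv.injective
  have h : ∀ x, e.toLinearEquiv (ρ g x) =
      Representation.directSum (fun p : (l : L) × Fin (n l) => σ p.1)
      g (e.toLinearEquiv x) := Representation.IntertwiningMap.isIntertwining _ _ e.toIntertwiningMap g
  rw [h]
  simp only [summandIncl, LinearMap.comp_apply, LinearEquiv.coe_coe, LinearEquiv.apply_symm_apply,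
    Representation.directSum_apply, DirectSum.lmap_lof]

/-- The matrix unit of the commutant that maps copy `b` of the irreducible `l` to copy `a`. -/
noncomputable def commutantUnit (l : L) (a b : Fin (n l)) : Module.End ℂ W :=
  summandIncl e ⟨l, a⟩ ∘ₗ summandProj e ⟨l, b⟩

theorem commutantUnit_mul_same (l : L) (a b c : Fin (n l)) :
    commutantUnit e l a b * commutantUnit e l b c = commutantUnit e l a c := by
  ext x
  exact congrArg (summandIncl e ⟨l, a⟩) (summandProj_incl e ⟨l, b⟩ _)

theorem commutantUnit_mul_of_ne (l : L) {a b b' c : Fin (n l)} (h : b ≠ b') :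
    commutantUnit e l a b * commutantUnit e l b' c = 0 := by
  ext x
  have : (⟨l, b'⟩ : (l : L) × Fin (n l)) ≠ ⟨l, b⟩ := by simpa using h.symm
  exact (congrArg (summandIncl e ⟨l, a⟩) (summandProj_incl_of_ne e this _)).trans (map_zero _)

theorem commutantUnit_mul_of_ne' {l l' : L} (h : l ≠ l') (a b : Fin (n l)) (a' b' : Fin (n l')) :
    commutantUnit e l a b * commutantUnit e l' a' b' = 0 := by
  ext x
  have : (⟨l', a'⟩ : (l : L) × Fin (n l)) ≠ ⟨l, b⟩ := fun h' => h (congrArg Sigma.fst h').symm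
  exact (congrArg (summandIncl e ⟨l, a⟩) (summandProj_incl_of_ne e this _)).trans (map_zero _)

variable [Fintype L]

/-- The element of the commutant with given matrix coefficients. -/
noncomputable def commutantOfMatrices (M : ∀ l, Matrix (Fin (n l)) (Fin (n l)) ℂ) :
    Module.End ℂ W :=
  ∑ l, ∑ a, ∑ b, M l a b • commutantUnit e l a b

theorem sum_commutantUnit : ∑ l, ∑ a, commutantUnit e l a a = 1 := by
  classical
  ext x
  apply e.toLinearEquiv.injective
  have hs : (∑ l, ∑ a, commutantUnit e l a a) x
      = ∑ p : (l : L) × Fin (n l), summandIncl e p (summandProj e p x) := by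
    simp only [LinearMap.sum_apply, Fintype.sum_sigma]
    rfl
  rw [hs, map_sum]
  simp only [summandIncl, summandProj, LinearMap.comp_apply, LinearEquiv.coe_coe,
    LinearEquiv.apply_symm_apply, Module.End.one_apply]
  generalize e.toLinearEquiv x = y
  refine DirectSum.ext_component ℂ fun p => ?_
  rw [map_sum, Finset.sum_eq_single p]
  · rw [component.lof_self]
  · intro q _ hq
    rw [component.of, dif_neg hq]
  · simp

theorem commutantOfMatrices_one : commutantOfMatrices e 1 = 1 := by
  rw [← sum_commutantUnit e, commutantOfMatrices]
  refine Finset.sum_congr rfl fun l _ => Finset.sum_congr rfl fun a _ => ?_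
  rw [Finset.sum_eq_single a]
  · simp
  · intro b _ hb
    simp [Matrix.one_apply_ne hb.symm]
  · simp

theorem commutantOfMatrices_mul (M N : ∀ l, Matrix (Fin (n l)) (Fin (n l)) ℂ) :
    commutantOfMatrices e M * commutantOfMatrices e N = commutantOfMatrices e (M * N) := by
  simp only [commutantOfMatrices, Finset.sum_mul]
  refine Finset.sum_congr rfl fun l _ => Finset.sum_congr rfl fun a _ => ?_
  have key : ∀ b, M l a b • commutantUnit e l a b *
      (∑ l, ∑ a, ∑ b, N l a b • commutantUnit e l a b) =
      ∑ c, (M l a b * N l b c) • commutantUnit e l a c := by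
    intro b
    rw [Finset.mul_sum, Finset.sum_eq_single l, Finset.mul_sum, Finset.sum_eq_single b,
      Finset.mul_sum]
    · simp [commutantUnit_mul_same, smul_smul, mul_comm]
    · intro b' _ hb
      simp [Finset.mul_sum, commutantUnit_mul_of_ne e l hb.symm]
    · simp
    · intro l' _ hl
      simp [Finset.mul_sum, commutantUnit_mul_of_ne' e hl.symm]
    · simp
  simp only [key]
  rw [Finset.sum_comm]
  refine Finset.sum_congr rfl fun c _ => ?_
  rw [← Finset.sum_smul, Pi.mul_apply, Matrix.mul_apply]

theorem commutantOfMatrices_pow (M : ∀ l, Matrix (Fin (n l)) (Fin (n l)) ℂ) (m : ℕ) :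
    commutantOfMatrices e M ^ m = commutantOfMatrices e (M ^ m) := by
  induction m with
  | zero => simp [commutantOfMatrices_one]
  | succ m ih => rw [pow_succ, ih, commutantOfMatrices_mul, pow_succ]

theorem exists_map_commutantOfMatrices (f : Module.End ℂ W →ₗ[ℂ] ℂ) :
    ∃ A : ∀ l, Matrix (Fin (n l)) (Fin (n l)) ℂ,
      ∀ M, f (commutantOfMatrices e M) = ∑ l, (A l * M l).trace := by
  refine ⟨fun l => Matrix.of fun b a => f (commutantUnit e l a b), fun M => ?_⟩
  simp only [commutantOfMatrices, map_sum, map_smul, Matrix.trace, Matrix.diag, Matrix.mul_apply,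
    Matrix.of_apply, smul_eq_mul]
  refine Finset.sum_congr rfl fun l _ => ?_
  rw [Finset.sum_comm]
  exact Finset.sum_congr rfl fun b _ => Finset.sum_congr rfl fun a _ => mul_comm _ _

/-- Schur's lemma on each block `π p ∘ t ∘ ι q`: it vanishes between inequivalent irreducibles and
is a scalar between copies of the same one. These scalars are the matrix entries. -/
theorem exists_eq_commutantOfMatrices [FiniteDimensional ℂ W]
    (hirr : ∀ l, (σ l).IsIrreducible) (hineq : ∀ l l', l ≠ l' → IsEmpty ((σ l).Equiv (σ l')))
    (t : Module.End ℂ W) (ht : ∀ g, t * ρ g = ρ g * t) :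
    ∃ M, t = commutantOfMatrices e M := by
  classical
  set ι := summandIncl e
  set π := summandProj e
  have hπι : ∀ p x, π p (ι p x) = x := summandProj_incl e
  have hπ : ∀ p g x, π p (ρ g x) = σ p.1 g (π p x) := summandProj_equivariant e
  have hι : ∀ p g x, ι p (σ p.1 g x) = ρ g (ι p x) := summandIncl_equivariant e
  let T : ∀ p q : (l : L) × Fin (n l), (σ q.1).IntertwiningMap (σ p.1) := fun p q =>
    ⟨π p ∘ₗ t ∘ₗ ι q, fun g => by
      ext x
      have := LinearMap.congr_fun (ht g) (ι q x)
      simp only [Module.End.mul_apply] at this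
      change π p (t (ι q (σ q.1 g x))) = σ p.1 g (π p (t (ι q x)))
      rw [hι, this, hπ]⟩
  have hT0 : ∀ p q, p.1 ≠ q.1 → ∀ x, π p (t (ι q x)) = 0 := fun p q h x => by
    have := hirr p.1
    have := hirr q.1
    have := hineq q.1 p.1 h.symm
    have h0 : T p q = 0 := Subsingleton.elim _ _
    exact DFunLike.congr_fun h0 x
  have hTc : ∀ l (a b : Fin (n l)), ∃ c : ℂ, ∀ x, π ⟨l, a⟩ (t (ι ⟨l, b⟩ x)) = c • x := by
    intro l a b
    have := hirr l
    -- Finite dimension, needed for the scalar form of Schur's lemma, is inherited from `W` as soon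
    -- as one copy of `V l` occurs.
    have : FiniteDimensional ℂ (V l) := FiniteDimensional.of_injective (ι ⟨l, a⟩)
      (Function.LeftInverse.injective (hπι ⟨l, a⟩))
    obtain ⟨c, hc⟩ :=
      (Representation.IsIrreducible.algebraMap_intertwiningMap_bijective_of_isAlgClosed (k := ℂ)
        (ρ := σ l)).2 (T ⟨l, a⟩ ⟨l, b⟩)
    refine ⟨c, fun x => ?_⟩
    have := DFunLike.congr_fun hc x
    exact this.symm
  choose M hM using hTc
  refine ⟨fun l => Matrix.of (M l), ?_⟩
  have hone := sum_commutantUnit e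
  have key : ∀ l a b, commutantUnit e l a a * t * commutantUnit e l b b
      = M l a b • commutantUnit e l a b := fun l a b => by
    ext x
    have h1 := hM l a b (π ⟨l, b⟩ x)
    have : ∀ y, commutantUnit e l a a y = ι ⟨l, a⟩ (π ⟨l, a⟩ y) := fun y => rfl
    have h2 : ∀ y, commutantUnit e l b b y = ι ⟨l, b⟩ (π ⟨l, b⟩ y) := fun y => rfl
    have h3 : ∀ y, commutantUnit e l a b y = ι ⟨l, a⟩ (π ⟨l, b⟩ y) := fun y => rfl
    rw [Module.End.mul_apply, Module.End.mul_apply, this, h2, h1, LinearMap.smul_apply, h3,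
      map_smul]
  have key0 : ∀ l l' (a : Fin (n l)) (b : Fin (n l')), l ≠ l' →
      commutantUnit e l a a * t * commutantUnit e l' b b = 0 := fun l l' a b h => by
    ext x
    have h1 := hT0 ⟨l, a⟩ ⟨l', b⟩ h (π ⟨l', b⟩ x)
    have : ∀ y, commutantUnit e l a a y = ι ⟨l, a⟩ (π ⟨l, a⟩ y) := fun y => rfl
    have h2 : ∀ y, commutantUnit e l' b b y = ι ⟨l', b⟩ (π ⟨l', b⟩ y) := fun y => rfl
    rw [Module.End.mul_apply, Module.End.mul_apply, this, h2, h1, map_zero, LinearMap.zero_apply]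
  calc t = (∑ l, ∑ a, commutantUnit e l a a) * t * (∑ l, ∑ a, commutantUnit e l a a) := by
        rw [hone, one_mul, mul_one]
    _ = commutantOfMatrices e fun l => Matrix.of (M l) := by
        simp only [commutantOfMatrices, Finset.sum_mul]
        refine Finset.sum_congr rfl fun l _ => Finset.sum_congr rfl fun a _ => ?_
        rw [Finset.mul_sum, Finset.sum_eq_single l, Finset.mul_sum]
        · exact Finset.sum_congr rfl fun b _ => key l a b
        · intro l' _ hl
          simp [Finset.mul_sum, key0 l l' a _ hl.symm]
        · simp

/-- The powers of an element of the commutant, in terms of its matrix blocks. -/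
theorem exists_matrix_powers_of_commute [FiniteDimensional ℂ W]
    (e : ρ.Equiv (Representation.directSum fun p : (l : L) × Fin (n l) => σ p.1))
    (hirr : ∀ l, (σ l).IsIrreducible) (hineq : ∀ l l', l ≠ l' → IsEmpty ((σ l).Equiv (σ l')))
    (t : Module.End ℂ W) (ht : ∀ g, t * ρ g = ρ g * t) :
    ∃ M : ∀ l, Matrix (Fin (n l)) (Fin (n l)) ℂ, ∀ f : Module.End ℂ W →ₗ[ℂ] ℂ,
      ∃ A : ∀ l, Matrix (Fin (n l)) (Fin (n l)) ℂ,
        ∀ m, f (t ^ m) = ∑ l, (A l * M l ^ m).trace := by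
  obtain ⟨M, rfl⟩ := exists_eq_commutantOfMatrices e hirr hineq t ht
  refine ⟨M, fun f => ?_⟩
  obtain ⟨A, hA⟩ := exists_map_commutantOfMatrices e f
  exact ⟨A, fun m => by rw [commutantOfMatrices_pow, hA]; rfl⟩

end Commutant

/-! ### The trace norm -/

section TraceNorm

open Matrix

variable {ι : Type*} [Fintype ι] [DecidableEq ι]

theorem toEuclideanLin_conjTranspose_mul_self_eigenvectorBasis (X : Matrix ι ι ℂ) (i : ι) :
    toEuclideanLin (Xᴴ * X) ((isHermitian_conjTranspose_mul_self X).eigenvectorBasis i) =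
      ((isHermitian_conjTranspose_mul_self X).eigenvalues i : ℂ) •
        (isHermitian_conjTranspose_mul_self X).eigenvectorBasis i := by
  have := (isHermitian_conjTranspose_mul_self X).mulVec_eigenvectorBasis i
  ext j
  have h := congrFun this j
  simpa [toLpLin_apply] using h

theorem inner_toEuclideanLin (X : Matrix ι ι ℂ) (u v : EuclideanSpace ℂ ι) :
    inner ℂ (toEuclideanLin X u) (toEuclideanLin X v)
      = inner ℂ u (toEuclideanLin (Xᴴ * X) v) := by
  rw [← LinearMap.adjoint_inner_right, ← toEuclideanLin_conjTranspose_eq_adjoint]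
  congr 1
  ext j
  simp [toLpLin_apply]

theorem norm_toEuclideanLin_eigenvectorBasis (X : Matrix ι ι ℂ) (i : ι) :
    ‖toEuclideanLin X ((isHermitian_conjTranspose_mul_self X).eigenvectorBasis i)‖ =
      Real.sqrt ((isHermitian_conjTranspose_mul_self X).eigenvalues i) := by
  rw [eq_comm, Real.sqrt_eq_iff_mul_self_eq
    ((posSemidef_conjTranspose_mul_self X).eigenvalues_nonneg i) (norm_nonneg _)]
  have := inner_toEuclideanLin X ((isHermitian_conjTranspose_mul_self X).eigenvectorBasis i)
    ((isHermitian_conjTranspose_mul_self X).eigenvectorBasis i)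
  rw [toEuclideanLin_conjTranspose_mul_self_eigenvectorBasis, inner_smul_right,
    inner_self_eq_norm_sq_to_K, inner_self_eq_norm_sq_to_K, OrthonormalBasis.norm_eq_one] at this
  have h2 : ‖toEuclideanLin X ((isHermitian_conjTranspose_mul_self X).eigenvectorBasis i)‖ ^ 2
      = (isHermitian_conjTranspose_mul_self X).eigenvalues i := by
    simp only [Complex.coe_algebraMap] at this
    norm_num at this
    exact_mod_cast this
  rw [← h2, sq]

theorem traceNorm_eq_sum_norm (X : Matrix ι ι ℂ) : traceNorm X =
    ∑ i, ‖toEuclideanLin X ((isHermitian_conjTranspose_mul_self X).eigenvectorBasis i)‖ := by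
  simp only [traceNorm, norm_toEuclideanLin_eigenvectorBasis]

theorem traceNorm_nonneg (X : Matrix ι ι ℂ) : 0 ≤ traceNorm X :=
  Finset.sum_nonneg fun _ _ => Real.sqrt_nonneg _

/-- Cauchy–Schwarz followed by Bessel's inequality for each family. -/
theorem sum_norm_inner_mul_inner_le {κ E : Type*} [Fintype κ] [NormedAddCommGroup E]
    [InnerProductSpace ℂ E] {a c : κ → E} (ha : Orthonormal ℂ a) (hc : Orthonormal ℂ c)
    (u v : E) : ∑ k, ‖inner ℂ (a k) u‖ * ‖inner ℂ v (c k)‖ ≤ ‖u‖ * ‖v‖ := by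
  refine (Real.sum_mul_le_sqrt_mul_sqrt _ _ _).trans (mul_le_mul ?_ ?_ (Real.sqrt_nonneg _)
    (norm_nonneg _))
  · rw [← Real.sqrt_sq (norm_nonneg u)]
    exact Real.sqrt_le_sqrt (ha.sum_inner_products_le u)
  · rw [← Real.sqrt_sq (norm_nonneg v)]
    refine Real.sqrt_le_sqrt
      (le_trans (le_of_eq ?_) (hc.sum_inner_products_le (s := Finset.univ) v))
    exact Finset.sum_congr rfl fun k _ => by rw [norm_inner_symm]

/-- Half of the variational formula for the trace norm: expand each `c k` in right singular vectors
of `X`. The formula makes subadditivity immediate. -/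
theorem sum_norm_inner_le_traceNorm {κ : Type*} [Fintype κ] {a c : κ → EuclideanSpace ℂ ι}
    (ha : Orthonormal ℂ a) (hc : Orthonormal ℂ c) (X : Matrix ι ι ℂ) :
    ∑ k, ‖inner ℂ (a k) (toEuclideanLin X (c k))‖ ≤ traceNorm X := by
  set v := (isHermitian_conjTranspose_mul_self X).eigenvectorBasis with hv
  have h1 : ∀ k, ‖inner ℂ (a k) (toEuclideanLin X (c k))‖ ≤
      ∑ i, ‖inner ℂ (a k) (toEuclideanLin X (v i))‖ * ‖inner ℂ (v i) (c k)‖ := by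
    intro k
    conv_lhs => rw [← v.sum_repr' (c k)]
    rw [map_sum, inner_sum]
    refine (norm_sum_le _ _).trans (Finset.sum_le_sum fun i _ => ?_)
    rw [map_smul, inner_smul_right, norm_mul, mul_comm]
  refine (Finset.sum_le_sum fun k _ => h1 k).trans ?_
  rw [Finset.sum_comm, traceNorm_eq_sum_norm]
  refine Finset.sum_le_sum fun i _ => (sum_norm_inner_mul_inner_le ha hc _ _).trans ?_
  rw [v.norm_eq_one, mul_one]

theorem exists_orthonormal_traceNorm_eq (X : Matrix ι ι ℂ) :
    ∃ (s : Finset ι) (a c : s → EuclideanSpace ℂ ι), Orthonormal ℂ a ∧ Orthonormal ℂ c ∧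
      traceNorm X = ∑ k, ‖inner ℂ (a k) (toEuclideanLin X (c k))‖ := by
  set v := (isHermitian_conjTranspose_mul_self X).eigenvectorBasis with hv
  set w : ι → EuclideanSpace ℂ ι := fun i => toEuclideanLin X (v i) with hw
  have hort : ∀ i j, i ≠ j → inner ℂ (w i) (w j) = 0 := fun i j hij => by
    rw [hw, inner_toEuclideanLin, toEuclideanLin_conjTranspose_mul_self_eigenvectorBasis,
      inner_smul_right, v.inner_eq_zero hij, mul_zero]
  -- The optimal pairs are right singular vectors and their normalized images; indices with zero
  -- image cannot be normalized and contribute nothing.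
  refine ⟨Finset.univ.filter fun i => w i ≠ 0, fun i => ((‖w i‖⁻¹ : ℝ) : ℂ) • w i, fun i => v i,
    ⟨fun i => ?_, fun i j hij => ?_⟩, v.orthonormal.comp _ Subtype.val_injective, ?_⟩
  · have : w i ≠ 0 := (Finset.mem_filter.1 i.2).2
    rw [norm_smul, Complex.norm_real, norm_inv, norm_norm, inv_mul_cancel₀ (norm_ne_zero_iff.2 this)]
  · change inner ℂ (((‖w i‖⁻¹ : ℝ) : ℂ) • w i) (((‖w j‖⁻¹ : ℝ) : ℂ) • w j) = 0
    rw [inner_smul_left, inner_smul_right, hort _ _ fun h => hij (Subtype.ext h), mul_zero, mul_zero]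
  · have h : ∀ i, w i ≠ 0 → ‖inner ℂ (((‖w i‖⁻¹ : ℝ) : ℂ) • w i) (w i)‖ = ‖w i‖ := fun i hi => by
      rw [inner_smul_left, inner_self_eq_norm_sq_to_K]
      have := norm_ne_zero_iff.2 hi
      simp only [norm_mul, Complex.conj_ofReal, Complex.norm_real, norm_inv, norm_norm, norm_pow,
        Complex.coe_algebraMap]
      field_simp
    rw [traceNorm_eq_sum_norm, Finset.sum_coe_sort (Finset.univ.filter fun i => w i ≠ 0)
      (fun i => ‖inner ℂ (((‖w i‖⁻¹ : ℝ) : ℂ) • w i) (toEuclideanLin X (v i))‖),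
      Finset.sum_filter]
    refine Finset.sum_congr rfl fun i _ => ?_
    split_ifs with hi
    · exact (h i hi).symm
    · rw [not_not] at hi
      exact norm_eq_zero.2 hi

theorem traceNorm_add_le (X Y : Matrix ι ι ℂ) : traceNorm (X + Y) ≤ traceNorm X + traceNorm Y := by
  obtain ⟨s, a, c, ha, hc, h⟩ := exists_orthonormal_traceNorm_eq (X + Y)
  rw [h]
  refine le_trans ?_ (add_le_add (sum_norm_inner_le_traceNorm ha hc X)
    (sum_norm_inner_le_traceNorm ha hc Y))
  rw [← Finset.sum_add_distrib]
  refine Finset.sum_le_sum fun k _ => ?_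
  rw [map_add, LinearMap.add_apply, inner_add_right]
  exact norm_add_le _ _

theorem traceNorm_smul_le (z : ℂ) (X : Matrix ι ι ℂ) : traceNorm (z • X) ≤ ‖z‖ * traceNorm X := by
  obtain ⟨s, a, c, ha, hc, h⟩ := exists_orthonormal_traceNorm_eq (z • X)
  rw [h]
  refine le_trans (le_of_eq ?_) (mul_le_mul_of_nonneg_left (sum_norm_inner_le_traceNorm ha hc X)
    (norm_nonneg z))
  simp only [map_smul, LinearMap.smul_apply, inner_smul_right, norm_mul, Finset.mul_sum]

theorem traceNorm_zero : traceNorm (0 : Matrix ι ι ℂ) = 0 := by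
  obtain ⟨s, a, c, ha, hc, h⟩ := exists_orthonormal_traceNorm_eq (0 : Matrix ι ι ℂ)
  rw [h]
  simp

theorem traceNorm_sum_le {κ : Type*} (s : Finset κ) (f : κ → Matrix ι ι ℂ) :
    traceNorm (∑ k ∈ s, f k) ≤ ∑ k ∈ s, traceNorm (f k) :=
  Finset.le_sum_of_subadditive traceNorm traceNorm_zero.le traceNorm_add_le s f

theorem traceNorm_rankOne_le (u v : EuclideanSpace ℂ ι) :
    traceNorm (Matrix.of fun i j => u i * star (v j)) ≤ ‖u‖ * ‖v‖ := by
  obtain ⟨s, a, c, ha, hc, h⟩ :=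
    exists_orthonormal_traceNorm_eq (Matrix.of fun i j => u i * star (v j))
  rw [h]
  refine le_trans (le_of_eq ?_) (sum_norm_inner_mul_inner_le ha hc u v)
  refine Finset.sum_congr rfl fun k _ => ?_
  have : toEuclideanLin (Matrix.of fun i j => u i * star (v j)) (c k) = inner ℂ v (c k) • u := by
    ext i
    simp [toLpLin_apply, mulVec, dotProduct, PiLp.inner_apply, Finset.sum_mul]
    exact Finset.sum_congr rfl fun j _ => by ring
  rw [this, inner_smul_right, norm_mul, mul_comm]

theorem sum_abs_eigenvalues_le_traceNorm {H : Matrix ι ι ℂ} (hH : H.IsHermitian) :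
    ∑ i, |hH.eigenvalues i| ≤ traceNorm H := by
  refine le_trans (le_of_eq ?_) (sum_norm_inner_le_traceNorm hH.eigenvectorBasis.orthonormal
    hH.eigenvectorBasis.orthonormal H)
  refine Finset.sum_congr rfl fun i _ => ?_
  have : toEuclideanLin H (hH.eigenvectorBasis i)
      = (hH.eigenvalues i : ℂ) • hH.eigenvectorBasis i := by
    ext j
    simpa [toLpLin_apply] using congrFun (hH.mulVec_eigenvectorBasis i) j
  rw [this, inner_smul_right, inner_self_eq_norm_sq_to_K, OrthonormalBasis.norm_eq_one]
  simp

theorem eq_sum_eigenvalues_smul_ketBra {H : Matrix ι ι ℂ} (hH : H.IsHermitian) :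
    H = ∑ i, (hH.eigenvalues i : ℂ) • ketBra (hH.eigenvectorBasis i) := by
  ext a b
  conv_lhs => rw [hH.spectral_theorem, Unitary.conjStarAlgAut_apply]
  simp [Matrix.mul_apply, Matrix.sum_apply, ketBra, Matrix.diagonal_apply, star_apply,
    IsHermitian.eigenvectorUnitary_apply]
  exact Finset.sum_congr rfl fun j _ => by ring

theorem norm_map_le_of_isHermitian (f : Module.Dual ℂ (Matrix ι ι ℂ)) {c : ℝ}
    (hf : ∀ ψ : EuclideanSpace ℂ ι, ‖ψ‖ = 1 → ‖f (ketBra ψ)‖ ≤ c) {H : Matrix ι ι ℂ}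
    (hH : H.IsHermitian) : ‖f H‖ ≤ (∑ i, |hH.eigenvalues i|) * c := by
  conv_lhs => rw [eq_sum_eigenvalues_smul_ketBra hH]
  rw [map_sum, Finset.sum_mul]
  refine (norm_sum_le _ _).trans (Finset.sum_le_sum fun i _ => ?_)
  rw [map_smul, norm_smul, Complex.norm_real, Real.norm_eq_abs]
  exact mul_le_mul_of_nonneg_left (hf _ (OrthonormalBasis.norm_eq_one _ i)) (abs_nonneg _)

end TraceNorm

/-! ### The diamond norm -/

section DiamondNorm

open Matrix

variable {d : ℕ}

/-- The sum of the absolute values of the entries of the Choi matrix. -/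
noncomputable def choiNorm (C : SuperOp d) : ℝ :=
  ∑ a, ∑ b, ∑ i, ∑ j, ‖C (Matrix.single a b 1) i j‖

theorem choiNorm_nonneg (C : SuperOp d) : 0 ≤ choiNorm C := by unfold choiNorm; positivity

theorem superOp_apply (C : SuperOp d) (X : Matrix (Fin d) (Fin d) ℂ) (i j : Fin d) :
    C X i j = ∑ a, ∑ b, X a b * C (Matrix.single a b 1) i j := by
  conv_lhs => rw [matrix_eq_sum_single X]
  simp only [map_sum, Matrix.sum_apply]
  refine Finset.sum_congr rfl fun a _ => Finset.sum_congr rfl fun b _ => ?_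
  have : Matrix.single a b (X a b) = X a b • Matrix.single a b (1 : ℂ) := by simp
  rw [this, map_smul, Matrix.smul_apply, smul_eq_mul]

/-- A bound independent of the reference dimension. It makes the supremum in `diamondNorm` a genuine
one, since `sSup` of an unbounded set of reals is `0`. -/
theorem traceNorm_tensorId_ketBra_le (C : SuperOp d) (r : ℕ)
    (ψ : EuclideanSpace ℂ (Fin d × Fin r)) (hψ : ‖ψ‖ = 1) :
    traceNorm (tensorId C r (ketBra ψ)) ≤ choiNorm C := by
  -- `u i a` is the vector `e_i ⊗ ψ_a`, where `ψ_a` is the component of `ψ` along `e_a`; the output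
  -- is then a combination of rank-one operators.
  let u : Fin d → Fin d → EuclideanSpace ℂ (Fin d × Fin r) := fun i a =>
    WithLp.toLp 2 fun p => if p.1 = i then ψ (a, p.2) else 0
  have hu : ∀ i a, ‖u i a‖ ≤ 1 := fun i a => by
    rw [← hψ, EuclideanSpace.norm_eq, EuclideanSpace.norm_eq]
    refine Real.sqrt_le_sqrt ?_
    rw [Fintype.sum_prod_type, Fintype.sum_prod_type, Finset.sum_eq_single i]
    · simp only [u, if_true]
      exact Finset.single_le_sum (f := fun a => ∑ k, ‖ψ (a, k)‖ ^ 2)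
        (fun a _ => by positivity) (Finset.mem_univ a)
    · intro j _ hj
      simp [u, hj]
    · simp
  have key : tensorId C r (ketBra ψ) = ∑ a, ∑ b, ∑ i, ∑ j, C (Matrix.single a b 1) i j •
      Matrix.of fun p q => u i a p * star (u j b q) := by
    ext p q
    simp only [tensorId, Matrix.of_apply, Matrix.sum_apply, Matrix.smul_apply, smul_eq_mul]
    rw [superOp_apply]
    refine Finset.sum_congr rfl fun a _ => Finset.sum_congr rfl fun b _ => ?_
    rw [Finset.sum_eq_single p.1, Finset.sum_eq_single q.1]
    · simp [u, ketBra, mul_comm]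
    · intro j _ hj
      simp [u, hj.symm]
    · simp
    · intro j _ hj
      simp [u, hj.symm]
    · simp
  rw [key, choiNorm]
  refine (traceNorm_sum_le _ _).trans (Finset.sum_le_sum fun a _ => ?_)
  refine (traceNorm_sum_le _ _).trans (Finset.sum_le_sum fun b _ => ?_)
  refine (traceNorm_sum_le _ _).trans (Finset.sum_le_sum fun i _ => ?_)
  refine (traceNorm_sum_le _ _).trans (Finset.sum_le_sum fun j _ => ?_)
  refine (traceNorm_smul_le _ _).trans (mul_le_of_le_one_right (norm_nonneg _) ?_)
  exact (traceNorm_rankOne_le _ _).trans (mul_le_one₀ (hu i a) (norm_nonneg _) (hu j b))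

theorem diamondNorm_le {C : SuperOp d} {c : ℝ} (hc : 0 ≤ c)
    (h : ∀ (r : ℕ) (ψ : EuclideanSpace ℂ (Fin d × Fin r)), ‖ψ‖ = 1 →
      traceNorm (tensorId C r (ketBra ψ)) ≤ c) : diamondNorm C ≤ c := by
  refine Real.sSup_le ?_ hc
  rintro x ⟨r, ψ, hψ, rfl⟩
  exact h r ψ hψ

theorem traceNorm_le_diamondNorm (C : SuperOp d) (r : ℕ)
    (ψ : EuclideanSpace ℂ (Fin d × Fin r)) (hψ : ‖ψ‖ = 1) :
    traceNorm (tensorId C r (ketBra ψ)) ≤ diamondNorm C := by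
  refine le_csSup ⟨choiNorm C, ?_⟩ ⟨r, ψ, hψ, rfl⟩
  rintro x ⟨r, ψ, hψ, rfl⟩
  exact traceNorm_tensorId_ketBra_le C r ψ hψ

theorem diamondNorm_nonneg (C : SuperOp d) : 0 ≤ diamondNorm C := by
  refine Real.sSup_nonneg ?_
  rintro x ⟨r, ψ, hψ, rfl⟩
  exact traceNorm_nonneg _

theorem diamondNorm_le_choiNorm (C : SuperOp d) : diamondNorm C ≤ choiNorm C :=
  diamondNorm_le (choiNorm_nonneg C) (traceNorm_tensorId_ketBra_le C)

theorem diamondNorm_add_le (C D : SuperOp d) :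
    diamondNorm (C + D) ≤ diamondNorm C + diamondNorm D :=
  diamondNorm_le (add_nonneg (diamondNorm_nonneg C) (diamondNorm_nonneg D)) fun r ψ hψ =>
    (traceNorm_add_le (tensorId C r (ketBra ψ)) (tensorId D r (ketBra ψ))).trans
      (add_le_add (traceNorm_le_diamondNorm C r ψ hψ) (traceNorm_le_diamondNorm D r ψ hψ))

theorem abs_diamondNorm_sub_le (C D : SuperOp d) :
    |diamondNorm C - diamondNorm D| ≤ choiNorm (C - D) := by
  have h1 := (diamondNorm_add_le (C - D) D).trans
    (add_le_add_left (diamondNorm_le_choiNorm (C - D)) _)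
  have h2 := (diamondNorm_add_le (D - C) C).trans
    (add_le_add_left (diamondNorm_le_choiNorm (D - C)) _)
  have h3 : choiNorm (D - C) = choiNorm (C - D) := by
    simp only [choiNorm, LinearMap.sub_apply, Matrix.sub_apply, norm_sub_rev]
  rw [sub_add_cancel] at h1 h2
  rw [abs_le]
  constructor <;> linarith

/-- The superoperator with given matrix coefficients `C(|a⟩⟨b|)_{ij}`. -/
noncomputable def superOpOfCoeff (d : ℕ) :
    (Fin d → Fin d → Fin d → Fin d → ℂ) →ₗ[ℂ] SuperOp d where
  toFun c :=
    { toFun X := Matrix.of fun i j => ∑ a, ∑ b, X a b * c a b i j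
      map_add' X Y := by ext; simp [add_mul, Finset.sum_add_distrib]
      map_smul' z X := by ext; simp [mul_assoc, Finset.mul_sum] }
  map_add' c c' := by ext; simp [mul_add, Finset.sum_add_distrib]
  map_smul' z c := by
    ext
    simp only [LinearMap.coe_mk, AddHom.coe_mk, Matrix.of_apply, LinearMap.smul_apply,
      Matrix.smul_apply, Pi.smul_apply, smul_eq_mul, Finset.mul_sum, RingHom.id_apply]
    exact Finset.sum_congr rfl fun _ _ => Finset.sum_congr rfl fun _ _ => by ring

theorem superOpOfCoeff_apply_self (C : SuperOp d) :
    superOpOfCoeff d (fun a b i j => C (Matrix.single a b 1) i j) = C := by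
  refine LinearMap.ext fun X => Matrix.ext fun i j => ?_
  rw [superOp_apply C]
  rfl

theorem superOpOfCoeff_single (c : Fin d → Fin d → Fin d → Fin d → ℂ) (a b i j : Fin d) :
    superOpOfCoeff d c (Matrix.single a b 1) i j = c a b i j := by
  change ∑ a', ∑ b', (Matrix.single a b (1 : ℂ)) a' b' * c a' b' i j = _
  rw [Finset.sum_eq_single a, Finset.sum_eq_single b]
  · simp
  · intro b' _ hb
    simp [hb.symm]
  · simp
  · intro a' _ ha
    simp [ha.symm]
  · simp

/-- Continuity in the coefficients makes `g ↦ diamondNorm (φ g)` measurable for measurable families.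
-/
theorem continuous_diamondNorm_superOpOfCoeff :
    Continuous fun c => diamondNorm (superOpOfCoeff d c) := by
  rw [continuous_iff_continuousAt]
  intro c
  rw [ContinuousAt, tendsto_iff_dist_tendsto_zero]
  have hlim : Filter.Tendsto (fun c' => choiNorm (superOpOfCoeff d (c' - c))) (nhds c) (nhds 0) := by
    have : Continuous fun c' => choiNorm (superOpOfCoeff d (c' - c)) := by
      simp only [choiNorm, superOpOfCoeff_single]
      fun_prop
    have h := this.tendsto c
    simp only [sub_self, map_zero] at h
    simpa [choiNorm] using h
  refine squeeze_zero (fun _ => dist_nonneg) (fun c' => ?_) hlim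
  rw [Real.dist_eq, map_sub]
  exact abs_diamondNorm_sub_le _ _

end DiamondNorm

/-! ### Functionals on states -/

section StateFunctional

open Matrix

variable {d : ℕ}

/-- Linear functionals on operators, normed by their values on pure states. -/
abbrev StateFunctional (d : ℕ) : Type := Module.Dual ℂ (Matrix (Fin d) (Fin d) ℂ)

/-- Testing on pure states alone keeps all estimates among Hermitian operators: positivity and trace
decrease suffice for contractivity, and a one-dimensional reference suffices in comparing with the
diamond norm. -/
noncomputable instance : Norm (StateFunctional d) where
  norm f := ⨆ ψ : {ψ : EuclideanSpace ℂ (Fin d) // ‖ψ‖ = 1}, ‖f (ketBra ψ.1)‖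

theorem StateFunctional.norm_def (f : StateFunctional d) :
    ‖f‖ = ⨆ ψ : {ψ : EuclideanSpace ℂ (Fin d) // ‖ψ‖ = 1}, ‖f (ketBra ψ.1)‖ := rfl

theorem StateFunctional.bddAbove (f : StateFunctional d) : BddAbove
    (Set.range fun ψ : {ψ : EuclideanSpace ℂ (Fin d) // ‖ψ‖ = 1} => ‖f (ketBra ψ.1)‖) := by
  refine ⟨∑ a, ∑ b, ‖f (Matrix.single a b 1)‖, ?_⟩
  rintro x ⟨⟨ψ, hψ⟩, rfl⟩
  have h : f (ketBra ψ) = ∑ a, ∑ b, (ψ a * star (ψ b)) • f (Matrix.single a b 1) := by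
    conv_lhs => rw [matrix_eq_sum_single (ketBra ψ)]
    simp only [map_sum, ← map_smul]
    simp [ketBra]
  have hc : ∀ a, ‖ψ a‖ ≤ 1 := fun a => hψ ▸ PiLp.norm_apply_le ψ a
  change ‖f (ketBra ψ)‖ ≤ _
  rw [h]
  refine (norm_sum_le _ _).trans (Finset.sum_le_sum fun a _ => ?_)
  refine (norm_sum_le _ _).trans (Finset.sum_le_sum fun b _ => ?_)
  rw [norm_smul, norm_mul, norm_star]
  exact mul_le_of_le_one_left (norm_nonneg _) (mul_le_one₀ (hc a) (norm_nonneg _) (hc b))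

theorem StateFunctional.norm_apply_ketBra_le (f : StateFunctional d)
    {ψ : EuclideanSpace ℂ (Fin d)} (hψ : ‖ψ‖ = 1) : ‖f (ketBra ψ)‖ ≤ ‖f‖ :=
  le_ciSup f.bddAbove ⟨ψ, hψ⟩

theorem StateFunctional.norm_le {f : StateFunctional d} {c : ℝ} (hc : 0 ≤ c)
    (h : ∀ ψ : EuclideanSpace ℂ (Fin d), ‖ψ‖ = 1 → ‖f (ketBra ψ)‖ ≤ c) : ‖f‖ ≤ c :=
  Real.iSup_le (fun ψ => h ψ.1 ψ.2) hc

theorem StateFunctional.nonneg_norm (f : StateFunctional d) : 0 ≤ ‖f‖ :=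
  Real.iSup_nonneg fun _ => norm_nonneg _

theorem StateFunctional.norm_apply_le_of_isHermitian (f : StateFunctional d)
    {H : Matrix (Fin d) (Fin d) ℂ} (hH : H.IsHermitian) :
    ‖f H‖ ≤ (∑ i, |hH.eigenvalues i|) * ‖f‖ :=
  norm_map_le_of_isHermitian f (fun _ hψ => f.norm_apply_ketBra_le hψ) hH

/-- Vanishing on pure states gives vanishing on Hermitian matrices by the spectral theorem, and
these span: use `X + Xᴴ` and the same expression for `i X`. -/
theorem StateFunctional.eq_zero_of_norm_eq_zero (f : StateFunctional d) (hf : ‖f‖ = 0) :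
    f = 0 := by
  have hH : ∀ H : Matrix (Fin d) (Fin d) ℂ, H.IsHermitian → f H = 0 := fun H hH => by
    have := f.norm_apply_le_of_isHermitian hH
    rw [hf, mul_zero] at this
    exact norm_le_zero_iff.1 this
  refine LinearMap.ext fun X => ?_
  have h1 := hH _ (isHermitian_add_transpose_self X)
  have h2 := hH _ (isHermitian_add_transpose_self (Complex.I • X))
  rw [map_add] at h1 h2
  rw [conjTranspose_smul, map_smul, map_smul] at h2
  simp only [Complex.star_def, Complex.conj_I, smul_eq_mul] at h2
  have h3 : Complex.I * (f X - f Xᴴ) = 0 := by linear_combination h2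
  have h4 := (mul_eq_zero.1 h3).resolve_left Complex.I_ne_zero
  change f X = 0
  linear_combination (h1 + h4) / 2

noncomputable instance : NormedAddCommGroup (StateFunctional d) :=
  fast_instance% AddGroupNorm.toNormedAddCommGroup
    { toFun f := ‖f‖
      map_zero' := le_antisymm (StateFunctional.norm_le le_rfl fun _ _ => by simp)
        (StateFunctional.nonneg_norm _)
      add_le' f g := StateFunctional.norm_le (add_nonneg f.nonneg_norm g.nonneg_norm) fun ψ hψ =>
        (norm_add_le _ _).trans
          (add_le_add (f.norm_apply_ketBra_le hψ) (g.norm_apply_ketBra_le hψ))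
      neg' f := by simp [StateFunctional.norm_def]
      eq_zero_of_map_eq_zero' f := f.eq_zero_of_norm_eq_zero }

noncomputable instance : NormedSpace ℂ (StateFunctional d) where
  norm_smul_le z f := StateFunctional.norm_le (mul_nonneg (norm_nonneg z) f.nonneg_norm)
    fun ψ hψ => by
      rw [LinearMap.smul_apply, norm_smul]
      exact mul_le_mul_of_nonneg_left (f.norm_apply_ketBra_le hψ) (norm_nonneg z)

noncomputable instance : MeasurableSpace (StateFunctional d) := borel _

instance : BorelSpace (StateFunctional d) := ⟨rfl⟩

/-- Evaluation of functionals at an operator. -/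
noncomputable def evalAt (X : Matrix (Fin d) (Fin d) ℂ) : StateFunctional d →L[ℂ] ℂ :=
  LinearMap.toContinuousLinearMap (Module.Dual.eval ℂ _ X)

/-- The Heisenberg picture of a superoperator: precomposition of functionals. -/
noncomputable def heisenberg (d : ℕ) :
    SuperOp d →ₗ[ℂ] StateFunctional d →L[ℂ] StateFunctional d :=
  LinearMap.toContinuousLinearMap.toLinearMap ∘ₗ Module.Dual.transpose

@[simp] theorem heisenberg_apply (C : SuperOp d) (f : StateFunctional d)
    (X : Matrix (Fin d) (Fin d) ℂ) : heisenberg d C f X = f (C X) := rfl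

theorem heisenberg_mul (C D : SuperOp d) :
    heisenberg d (C * D) = heisenberg d D * heisenberg d C := rfl

theorem heisenberg_one : heisenberg d 1 = 1 := rfl

theorem posSemidef_ketBra {ι : Type*} [Fintype ι] (ψ : EuclideanSpace ℂ ι) :
    (ketBra ψ).PosSemidef :=
  posSemidef_vecMulVec_self_star ψ.ofLp

theorem trace_ketBra {ι : Type*} [Fintype ι] (ψ : EuclideanSpace ℂ ι) :
    (ketBra ψ).trace = (‖ψ‖ ^ 2 : ℝ) := by
  rw [EuclideanSpace.norm_sq_eq]
  push_cast
  simp [ketBra, Matrix.trace, Complex.mul_conj, Complex.normSq_eq_norm_sq]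

theorem IsCompletelyPositive.posSemidef {C : SuperOp d} (hC : IsCompletelyPositive C)
    {X : Matrix (Fin d) (Fin d) ℂ} (hX : X.PosSemidef) : (C X).PosSemidef :=
  (hC 1 (X.submatrix Prod.fst Prod.fst) (hX.submatrix _)).submatrix fun i => (i, 0)

/-- Diagonalize the Hermitian output `C (ketBra ψ)`: the functional costs at most the sum of
absolute eigenvalues, which is bounded by the trace norm for a trivial reference system. -/
theorem norm_heisenberg_le_diamondNorm {C : SuperOp d}
    (hC : ∀ ψ : EuclideanSpace ℂ (Fin d), (C (ketBra ψ)).IsHermitian) :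
    ‖heisenberg d C‖ ≤ diamondNorm C := by
  refine ContinuousLinearMap.opNorm_le_bound _ (diamondNorm_nonneg C) fun f => ?_
  refine StateFunctional.norm_le (mul_nonneg (diamondNorm_nonneg C) (norm_nonneg f)) fun ψ hψ => ?_
  let ψ' : EuclideanSpace ℂ (Fin d × Fin 1) := WithLp.toLp 2 fun p => ψ p.1
  have hψ' : ‖ψ'‖ = 1 := by
    rw [← hψ, EuclideanSpace.norm_eq, EuclideanSpace.norm_eq, Fintype.sum_prod_type]
    simp [ψ']
  have hT : tensorId C 1 (ketBra ψ') = (C (ketBra ψ)).submatrix Prod.fst Prod.fst := rfl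
  have hH : (tensorId C 1 (ketBra ψ')).IsHermitian := by
    rw [hT]; exact (hC ψ).submatrix _
  let s : Fin d → Fin d × Fin 1 := fun i => (i, 0)
  let f' : Module.Dual ℂ (Matrix (Fin d × Fin 1) (Fin d × Fin 1) ℂ) :=
    { toFun X := f (X.submatrix s s)
      map_add' X Y := map_add f _ _
      map_smul' z X := map_smul f z _ }
  have h := norm_map_le_of_isHermitian f' (c := ‖f‖) (fun χ hχ => by
    refine f.norm_apply_ketBra_le (ψ := WithLp.toLp 2 fun i => χ (s i)) ?_
    rw [← hχ, EuclideanSpace.norm_eq, EuclideanSpace.norm_eq, Fintype.sum_prod_type]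
    simp [s]) hH
  refine (show ‖f' (tensorId C 1 (ketBra ψ'))‖ ≤ _ from h).trans ?_
  exact mul_le_mul_of_nonneg_right ((sum_abs_eigenvalues_le_traceNorm hH).trans
    (traceNorm_le_diamondNorm C 1 ψ' hψ')) (norm_nonneg f)

theorem StateFunctional.norm_apply_le_of_posSemidef (f : StateFunctional d)
    {X : Matrix (Fin d) (Fin d) ℂ} (hX : X.PosSemidef) : ‖f X‖ ≤ X.trace.re * ‖f‖ := by
  refine (f.norm_apply_le_of_isHermitian hX.1).trans (le_of_eq ?_)
  rw [hX.1.trace_eq_sum_eigenvalues]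
  simp only [abs_of_nonneg (hX.eigenvalues_nonneg _), Complex.re_sum]
  rfl

theorem norm_heisenberg_le_one {C : SuperOp d} (hC : IsQuantumOperation C) :
    ‖heisenberg d C‖ ≤ 1 := by
  refine ContinuousLinearMap.opNorm_le_bound _ zero_le_one fun f => ?_
  rw [one_mul]
  refine StateFunctional.norm_le (norm_nonneg f) fun ψ hψ => ?_
  refine (f.norm_apply_le_of_posSemidef (hC.1.posSemidef (posSemidef_ketBra ψ))).trans
    (mul_le_of_le_one_left (norm_nonneg f) ((hC.2 _ (posSemidef_ketBra ψ)).trans ?_))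
  simp [trace_ketBra, hψ]

theorem IsQuantumChannel.isQuantumOperation {C : SuperOp d} (hC : IsQuantumChannel C) :
    IsQuantumOperation C :=
  ⟨hC.1, fun X _ => by rw [hC.2]⟩

/-- The functional `X ↦ Tr (E X)`. -/
noncomputable def traceFunctional (E : Matrix (Fin d) (Fin d) ℂ) : StateFunctional d :=
  Matrix.traceLinearMap _ ℂ ℂ ∘ₗ LinearMap.mulLeft ℂ E

theorem norm_traceFunctional_le_one {k : ℕ} {P : Fin k → Matrix (Fin d) (Fin d) ℂ}
    (hP : IsPOVM P) (i : Fin k) : ‖traceFunctional (P i)‖ ≤ 1 := by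
  refine StateFunctional.norm_le zero_le_one fun ψ hψ => ?_
  have hpos : ∀ j, 0 ≤ (P j * ketBra ψ).trace := fun j => by
    have h := (hP.1 j).dotProduct_mulVec_nonneg ψ.ofLp
    have e : (P j * ketBra ψ).trace = star ψ.ofLp ⬝ᵥ P j *ᵥ ψ.ofLp := by
      change (P j * vecMulVec ψ.ofLp (star ψ.ofLp)).trace = _
      rw [mul_vecMulVec, trace_vecMulVec, dotProduct_comm]
    rwa [e]
  have hsum : ∑ j, (P j * ketBra ψ).trace = 1 := by
    rw [← Matrix.trace_sum, ← Finset.sum_mul, hP.2, one_mul, trace_ketBra, hψ]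
    simp
  have hle : (P i * ketBra ψ).trace ≤ 1 := hsum ▸
    Finset.single_le_sum (f := fun j => (P j * ketBra ψ).trace) (fun j _ => hpos j)
      (Finset.mem_univ i)
  have h : ((‖(P i * ketBra ψ).trace‖ : ℝ) : ℂ) ≤ (1 : ℝ) := by
    rw [Complex.norm_of_nonneg' (hpos i)]
    exact_mod_cast hle
  exact_mod_cast h

/-- Taking the real part in `conditionalProb` therefore loses nothing. -/
theorem ofReal_re_trace_mul {E X : Matrix (Fin d) (Fin d) ℂ} (hE : E.IsHermitian)
    (hX : X.IsHermitian) : ((E * X).trace.re : ℂ) = (E * X).trace := by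
  rw [← Complex.conj_eq_iff_re, ← Complex.star_def, ← trace_conjTranspose, conjTranspose_mul,
    hE.eq, hX.eq, trace_mul_comm]

end StateFunctional

/-! ### Bounded measurable functions -/

section BoundedMeasurable

open scoped ENNReal

/-- The Banach space of bounded measurable functions, with the supremum norm. -/
def boundedMeasurable (G E : Type*) [MeasurableSpace G] [NormedAddCommGroup E] [NormedSpace ℂ E] :
    Submodule ℂ (lp (fun _ : G => E) ∞) where
  carrier := {F | StronglyMeasurable (F : G → E)}
  add_mem' hF hF' := StronglyMeasurable.add hF hF'
  zero_mem' := stronglyMeasurable_zero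
  smul_mem' c _ hF := StronglyMeasurable.const_smul hF c

variable {G E : Type*} [MeasurableSpace G] [NormedAddCommGroup E] [NormedSpace ℂ E]

theorem isClosed_boundedMeasurable :
    IsClosed (boundedMeasurable G E : Set (lp (fun _ : G => E) ∞)) := by
  refine IsSeqClosed.isClosed fun u F hu hF => ?_
  refine stronglyMeasurable_of_tendsto Filter.atTop hu (tendsto_pi_nhds.2 fun g => ?_)
  exact ((lp.lipschitzWith_one_eval ∞ g).continuous.tendsto F).comp hF

instance [CompleteSpace E] : CompleteSpace (boundedMeasurable G E) :=
  isClosed_boundedMeasurable.completeSpace_coe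

namespace boundedMeasurable

instance : CoeFun (boundedMeasurable G E) fun _ => G → E := ⟨fun F => (F.1 : G → E)⟩

theorem stronglyMeasurable (F : boundedMeasurable G E) : StronglyMeasurable F := F.2

theorem norm_apply_le (F : boundedMeasurable G E) (g : G) : ‖F g‖ ≤ ‖F‖ :=
  lp.norm_apply_le_norm ENNReal.top_ne_zero F.1 g

theorem norm_le {F : boundedMeasurable G E} {c : ℝ} (hc : 0 ≤ c) (h : ∀ g, ‖F g‖ ≤ c) :
    ‖F‖ ≤ c :=
  lp.norm_le_of_forall_le (f := F.1) hc h

@[ext] theorem ext {F F' : boundedMeasurable G E} (h : ∀ g, F g = F' g) : F = F' :=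
  Subtype.ext (lp.ext (funext h))

/-- A bounded measurable function as an element of `boundedMeasurable`. -/
def mk (F : G → E) (hF : StronglyMeasurable F) (c : ℝ) (h : ∀ g, ‖F g‖ ≤ c) :
    boundedMeasurable G E :=
  ⟨⟨F, memℓp_infty ⟨c, by rintro _ ⟨g, rfl⟩; exact h g⟩⟩, hF⟩

@[simp] theorem mk_apply (F : G → E) (hF : StronglyMeasurable F) (c : ℝ) (h : ∀ g, ‖F g‖ ≤ c)
    (g : G) : mk F hF c h g = F g := rfl

@[simp] theorem add_apply (F F' : boundedMeasurable G E) (g : G) : (F + F') g = F g + F' g := rfl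

@[simp] theorem sub_apply (F F' : boundedMeasurable G E) (g : G) : (F - F') g = F g - F' g := rfl

@[simp] theorem smul_apply (c : ℂ) (F : boundedMeasurable G E) (g : G) : (c • F) g = c • F g := rfl

/-- Evaluation of a bounded measurable function at a point. -/
noncomputable def eval (g : G) : boundedMeasurable G E →L[ℂ] E :=
  LinearMap.mkContinuous { toFun F := F g, map_add' _ _ := rfl, map_smul' _ _ := rfl } 1
    fun F => by rw [one_mul]; exact norm_apply_le F g

/-- A bounded linear map into the bounded measurable functions. -/
noncomputable def liftCLM {V : Type*} [NormedAddCommGroup V] [NormedSpace ℂ V]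
    (T : V →ₗ[ℂ] (G → E)) (hT : ∀ v, StronglyMeasurable (T v)) (hb : ∀ v g, ‖T v g‖ ≤ ‖v‖) :
    V →L[ℂ] boundedMeasurable G E :=
  LinearMap.mkContinuous
    { toFun v := mk (T v) (hT v) ‖v‖ (hb v)
      map_add' v w := by ext g; simp
      map_smul' c v := by ext g; simp } 1
    fun v => by rw [one_mul]; exact norm_le (norm_nonneg v) (hb v)

theorem norm_liftCLM_le {V : Type*} [NormedAddCommGroup V] [NormedSpace ℂ V]
    (T : V →ₗ[ℂ] (G → E)) (hT : ∀ v, StronglyMeasurable (T v)) (hb : ∀ v g, ‖T v g‖ ≤ ‖v‖) :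
    ‖liftCLM T hT hb‖ ≤ 1 :=
  LinearMap.mkContinuous_norm_le _ zero_le_one _

end boundedMeasurable

end BoundedMeasurable

/-! ### Perturbation of a retraction onto a subspace -/

section Retraction

variable {G E B : Type*} [Group G] [NormedAddCommGroup E] [NormedSpace ℂ E] [NormedAddCommGroup B]
  [NormedSpace ℂ B]

/-- Consecutive factors meet in `V J = 1`. Positivity of `m` matters: for `m = 0` the right side is
`J V`, a projection and not in general the identity. -/
theorem pow_comp_of_retraction {J : E →L[ℂ] B} {V : B →L[ℂ] E} (hVJ : V ∘L J = 1)
    (t : E →L[ℂ] E) {m : ℕ} (hm : 0 < m) : (J ∘L t ∘L V) ^ m = J ∘L (t ^ m) ∘L V := by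
  induction m, hm using Nat.le_induction with
  | base => rw [pow_one, pow_one]
  | succ m _ ih =>
    rw [pow_succ, ih, pow_succ]
    change J ∘L (t ^ m) ∘L (V ∘L J) ∘L t ∘L V = _
    rw [hVJ]
    rfl

/-- Let `a` be a perturbation of the projection `J V` onto a subspace. If `a` commutes with a group
action `T` that restricts to `w` on the subspace, then the powers of `a` are governed by the powers
of an operator that commutes with `w`. -/
theorem exists_pow_approx_of_retraction [CompleteSpace B] {a : B →L[ℂ] B} {J : E →L[ℂ] B}
    {V : B →L[ℂ] E} (hVJ : V ∘L J = 1) (hP : ‖J ∘L V‖ ≤ 1) {δ : ℝ} (h0 : 0 ≤ δ) (h1 : δ < 1 / 9)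
    (ha : ‖a - J ∘L V‖ ≤ δ) {T : G → B →L[ℂ] B} {w : G → E →L[ℂ] E} (hT : ∀ h, ‖T h‖ ≤ 1)
    (hTT : ∀ h, T h * T h⁻¹ = 1) (hTa : ∀ h, Commute (T h) a)
    (hTJ : ∀ h, T h ∘L J = J ∘L w h) (hVT : ∀ h, V ∘L T h = w h ∘L V) :
    ∃ (t : E →L[ℂ] E) (S : E →L[ℂ] B) (U : B →L[ℂ] E),
      (∀ h, t * w h = w h * t) ∧ ∀ m : ℕ, 0 < m →
        ‖a ^ m - S ∘L (t ^ m) ∘L U‖ ≤ 9 / 2 * (δ * (2 + riccatiBound δ)) ^ m := by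
  obtain ⟨P, hJV⟩ : ∃ P, P = J ∘L V := ⟨_, rfl⟩
  rw [← hJV] at hP ha
  have hone : ‖(1 : B →L[ℂ] B)‖ ≤ 1 := ContinuousLinearMap.norm_id_le
  have hQ : ‖1 - P‖ ≤ 2 := (norm_sub_le 1 P).trans (by linarith)
  have hPP : P * P = P := by
    rw [hJV]
    change J ∘L (V ∘L J) ∘L V = _
    rw [hVJ]
    rfl
  have hTP : ∀ h, Commute (T h) P := fun h => by
    rw [hJV]
    change (T h ∘L J) ∘L V = J ∘L (V ∘L T h)
    rw [hTJ, hVT]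
    rfl
  obtain ⟨X, hXn, hX⟩ := exists_isRiccatiSolution (A := B →L[ℂ] B) hP hQ h0 h1 ha
  obtain ⟨U, hU⟩ := exists_pow_decomposition hPP hP hQ h0 h1 ha hX hXn
  have hcomp : compression P a X = J ∘L (V ∘L (a * (P + X)) ∘L J) ∘L V := by
    rw [hX.compression_eq hPP hP hQ h0 h1 ha hXn]
    generalize a * (P + X) = Y
    rw [hJV]
    rfl
  -- `t` is the compression transported to `E` along the retraction, so that `compression P a X = J
  -- t V`.
  refine ⟨V ∘L (a * (P + X)) ∘L J, (P + X) ∘L J, V ∘L U, fun h => ?_, fun m hm => ?_⟩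
  · have hcX : Commute (T h) X := hX.commute hP hQ h0 h1 ha hXn (hTT h)
      (by simpa using hTT h⁻¹) (hT h) (hT h⁻¹) (hTP h) (hTa h)
    have hc : Commute (T h) (a * (P + X)) := (hTa h).mul_right ((hTP h).add_right hcX)
    generalize a * (P + X) = Y at hc
    calc V ∘L Y ∘L J * w h = V ∘L Y ∘L (J ∘L w h) := rfl
      _ = V ∘L (Y * T h) ∘L J := by rw [← hTJ h]; rfl
      _ = (V ∘L T h) ∘L Y ∘L J := by rw [← hc.eq]; rfl
      _ = w h * V ∘L Y ∘L J := by rw [hVT h]; rfl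
  · have h := hU m
    rw [hcomp, pow_comp_of_retraction hVJ _ hm] at h
    exact h

end Retraction

/-! ### Convolution operators -/

section Convolution

variable {G E : Type*} [MeasurableSpace G] [NormedAddCommGroup E] [NormedSpace ℂ E]

theorem stronglyMeasurable_clm_apply {α : Type*} [MeasurableSpace α] {p : α → E →L[ℂ] E}
    {f : α → E} (hp : StronglyMeasurable p) (hf : StronglyMeasurable f) :
    StronglyMeasurable fun a => p a (f a) :=
  isBoundedBilinearMap_apply.continuous.comp_stronglyMeasurable (hp.prodMk hf)

/-- A measurable family of contractions. -/
structure IsContractionFamily (p : G → E →L[ℂ] E) : Prop where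
  stronglyMeasurable : StronglyMeasurable p
  norm_le_one : ∀ g, ‖p g‖ ≤ 1

theorem IsContractionFamily.norm_apply_le {p : G → E →L[ℂ] E} (hp : IsContractionFamily p) (g : G)
    (v : E) : ‖p g v‖ ≤ ‖v‖ :=
  ((p g).le_opNorm v).trans (mul_le_of_le_one_left (norm_nonneg v) (hp.norm_le_one g))

section

variable [Group G] [MeasurableMul G]

/-- Left translation of functions. -/
noncomputable def leftTranslation (E : Type*) [NormedAddCommGroup E] [NormedSpace ℂ E] (h : G) :
    boundedMeasurable G E →L[ℂ] boundedMeasurable G E :=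
  boundedMeasurable.liftCLM { toFun F x := F (h * x), map_add' _ _ := rfl, map_smul' _ _ := rfl }
    (fun F => (boundedMeasurable.stronglyMeasurable F).comp_measurable (measurable_const_mul h))
    fun F x => boundedMeasurable.norm_apply_le F (h * x)

theorem leftTranslation_mul_of_mul_eq_one {h h' : G} (hh : h' * h = 1) :
    leftTranslation E h * leftTranslation E h' = 1 := by
  ext F x
  change F (h' * (h * x)) = F x
  rw [← mul_assoc, hh, one_mul]

end

variable [Group G] [MeasurableMul₂ G] [MeasurableInv G]

namespace IsContractionFamily

variable {p : G → E →L[ℂ] E} (hp : IsContractionFamily p)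

include hp

theorem stronglyMeasurable_convolution (F : boundedMeasurable G E) :
    StronglyMeasurable fun q : G × G => p q.2 (F (q.1 * q.2⁻¹)) :=
  stronglyMeasurable_clm_apply (hp.stronglyMeasurable.comp_measurable measurable_snd)
    ((boundedMeasurable.stronglyMeasurable F).comp_measurable
      (measurable_fst.mul measurable_snd.inv))

theorem integrable_convolution (μ : Measure G) [IsProbabilityMeasure μ]
    (F : boundedMeasurable G E) (x : G) : Integrable (fun g => p g (F (x * g⁻¹))) μ :=
  Integrable.of_bound
    ((hp.stronglyMeasurable_convolution F).comp_measurable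
      measurable_prodMk_left).aestronglyMeasurable ‖F‖
    (Filter.Eventually.of_forall fun g =>
      (hp.norm_apply_le g _).trans (boundedMeasurable.norm_apply_le F _))

omit [MeasurableMul₂ G] [MeasurableInv G] in
theorem norm_convolution_le (μ : Measure G) [IsProbabilityMeasure μ]
    (F : boundedMeasurable G E) (x : G) : ‖∫ g, p g (F (x * g⁻¹)) ∂μ‖ ≤ ‖F‖ := by
  have := norm_integral_le_of_norm_le_const (μ := μ) (f := fun g => p g (F (x * g⁻¹)))
    (Filter.Eventually.of_forall fun g =>
      (hp.norm_apply_le g _).trans (boundedMeasurable.norm_apply_le F _))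
  simpa using this

/-- Convolution `F ↦ ∫ p(g) F(x g⁻¹) dg` with a measurable family of contractions. -/
noncomputable def convolution (μ : Measure G) [IsProbabilityMeasure μ] :
    boundedMeasurable G E →L[ℂ] boundedMeasurable G E :=
  boundedMeasurable.liftCLM
    { toFun F x := ∫ g, p g (F (x * g⁻¹)) ∂μ
      map_add' F F' := by
        ext x
        simp only [boundedMeasurable.add_apply, map_add, Pi.add_apply]
        exact integral_add (hp.integrable_convolution μ F x) (hp.integrable_convolution μ F' x)
      map_smul' c F := by
        ext x
        simp only [boundedMeasurable.smul_apply, map_smul, Pi.smul_apply, RingHom.id_apply]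
        exact integral_smul c _ }
    (fun F => (hp.stronglyMeasurable_convolution F).integral_prod_right)
    (hp.norm_convolution_le μ)

theorem convolution_apply (μ : Measure G) [IsProbabilityMeasure μ]
    (F : boundedMeasurable G E) (x : G) :
    hp.convolution μ F x = ∫ g, p g (F (x * g⁻¹)) ∂μ := rfl

theorem norm_convolution_sub_le {w : G → E →L[ℂ] E} (hw : IsContractionFamily w)
    (μ : Measure G) [IsProbabilityMeasure μ] :
    ‖hp.convolution μ - hw.convolution μ‖ ≤ ∫ g, ‖p g - w g‖ ∂μ := by
  have h0 : 0 ≤ ∫ g, ‖p g - w g‖ ∂μ := integral_nonneg fun _ => norm_nonneg _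
  have hint : Integrable (fun g => ‖p g - w g‖) μ :=
    Integrable.of_bound (hp.stronglyMeasurable.sub hw.stronglyMeasurable).norm.aestronglyMeasurable
      2 (Filter.Eventually.of_forall fun g => by
        rw [norm_norm]
        exact (norm_sub_le _ _).trans (by linarith [hp.norm_le_one g, hw.norm_le_one g]))
  refine ContinuousLinearMap.opNorm_le_bound _ h0 fun F => ?_
  refine boundedMeasurable.norm_le (mul_nonneg h0 (norm_nonneg F)) fun x => ?_
  change ‖(∫ g, p g (F (x * g⁻¹)) ∂μ) - ∫ g, w g (F (x * g⁻¹)) ∂μ‖ ≤ _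
  rw [← integral_sub (hp.integrable_convolution μ F x) (hw.integrable_convolution μ F x),
    ← integral_mul_const]
  refine norm_integral_le_of_norm_le (hint.mul_const _) (Filter.Eventually.of_forall fun g => ?_)
  rw [← _root_.sub_apply]
  exact ((p g - w g).le_opNorm _).trans
    (mul_le_mul_of_nonneg_left (boundedMeasurable.norm_apply_le F _) (norm_nonneg _))

end IsContractionFamily

/-- Convolution acts on the argument from the right, so left translation commutes with it by
associativity. -/
theorem IsContractionFamily.commute_leftTranslation {p : G → E →L[ℂ] E}
    (hp : IsContractionFamily p) (μ : Measure G) [IsProbabilityMeasure μ] (h : G) :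
    Commute (leftTranslation E h) (hp.convolution μ) := by
  ext F x
  change ∫ g, p g (F (h * x * g⁻¹)) ∂μ = ∫ g, p g (F (h * (x * g⁻¹))) ∂μ
  simp only [mul_assoc]

/-- A measurable anti-representation by contractions. -/
structure IsContractionAntirep (w : G → E →L[ℂ] E) : Prop extends IsContractionFamily w where
  map_one : w 1 = 1
  map_mul : ∀ g h, w (g * h) = w h * w g

namespace IsContractionAntirep

variable {w : G → E →L[ℂ] E} (hw : IsContractionAntirep w)

include hw

/-- The equivariant functions `x ↦ w(x) f`. -/
noncomputable def orbitMap : E →L[ℂ] boundedMeasurable G E :=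
  boundedMeasurable.liftCLM
    { toFun f x := w x f
      map_add' f f' := by ext x; exact _root_.map_add (w x) f f'
      map_smul' c f := by ext x; exact _root_.map_smul (w x) c f }
    (fun _ => stronglyMeasurable_clm_apply hw.stronglyMeasurable stronglyMeasurable_const)
    fun f x => hw.norm_apply_le x f

omit [MeasurableMul₂ G] [MeasurableInv G] in
theorem orbitMap_apply (f : E) (x : G) : hw.orbitMap f x = w x f := rfl

variable (μ : Measure G) [IsProbabilityMeasure μ]

/-- The average `F ↦ ∫ w(g) F(g⁻¹) dg`. -/
noncomputable def average : boundedMeasurable G E →L[ℂ] E :=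
  boundedMeasurable.eval 1 ∘L hw.toIsContractionFamily.convolution μ

theorem average_apply (F : boundedMeasurable G E) : hw.average μ F = ∫ g, w g (F g⁻¹) ∂μ := by
  change ∫ g, w g (F (1 * g⁻¹)) ∂μ = _
  simp only [one_mul]

theorem average_comp_orbitMap [CompleteSpace E] : hw.average μ ∘L hw.orbitMap = 1 := by
  ext f
  rw [ContinuousLinearMap.comp_apply, average_apply]
  have : ∀ g, w g (hw.orbitMap f g⁻¹) = f := fun g => by
    rw [orbitMap_apply, ← mul_apply_eq_comp, ← hw.map_mul, inv_mul_cancel, hw.map_one]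
    rfl
  simp [this]

theorem norm_convolution_le_one : ‖hw.toIsContractionFamily.convolution μ‖ ≤ 1 :=
  boundedMeasurable.norm_liftCLM_le _ _ _

variable [μ.IsMulRightInvariant]

/-- Pull `w x` inside the integral and substitute `g ↦ g x`; this is where right invariance enters.
It identifies the reference convolution with the idempotent `J V`. -/
theorem orbitMap_comp_average [CompleteSpace E] : hw.orbitMap ∘L hw.average μ
    = hw.toIsContractionFamily.convolution μ := by
  ext F x
  rw [ContinuousLinearMap.comp_apply, orbitMap_apply, average_apply,
    IsContractionFamily.convolution_apply,
    ← integral_mul_right_eq_self (fun g => w g (F (x * g⁻¹))) x,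
    ← ContinuousLinearMap.integral_comp_comm]
  · refine integral_congr_ae (Filter.Eventually.of_forall fun g => ?_)
    simp only [hw.map_mul, mul_inv_rev, mul_inv_cancel_left]
    rfl
  · simpa using hw.integrable_convolution μ F 1

omit [MeasurableInv G] in
theorem leftTranslation_comp_orbitMap (h : G) :
    leftTranslation E h ∘L hw.orbitMap = hw.orbitMap ∘L w h := by
  ext f x
  change w (h * x) f = w x (w h f)
  rw [hw.map_mul]
  rfl

theorem average_comp_leftTranslation [CompleteSpace E] (h : G) :
    hw.average μ ∘L leftTranslation E h = w h ∘L hw.average μ := by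
  ext F
  have h1 : w h (hw.average μ F) = hw.toIsContractionFamily.convolution μ F h := by
    rw [← hw.orbitMap_comp_average μ]
    rfl
  change hw.average μ (leftTranslation E h F) = w h (hw.average μ F)
  rw [h1, average_apply]
  rfl

/-- Powers of the convolution with a perturbation of an anti-representation `w` are governed by the
powers of an operator commuting with `w`. -/
theorem exists_convolution_pow_approx [CompleteSpace E] {p : G → E →L[ℂ] E}
    (hp : IsContractionFamily p) {δ : ℝ} (hδ : ∫ g, ‖p g - w g‖ ∂μ ≤ δ) (h1 : δ < 1 / 9) :
    ∃ (t : E →L[ℂ] E) (S : E →L[ℂ] boundedMeasurable G E) (U : boundedMeasurable G E →L[ℂ] E),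
      (∀ h, t * w h = w h * t) ∧ ∀ m : ℕ, 0 < m →
        ‖hp.convolution μ ^ m - S ∘L (t ^ m) ∘L U‖ ≤ 9 / 2 * (δ * (2 + riccatiBound δ)) ^ m := by
  refine exists_pow_approx_of_retraction (hw.average_comp_orbitMap μ)
    (by rw [hw.orbitMap_comp_average μ]; exact hw.norm_convolution_le_one μ)
    ((integral_nonneg fun _ => norm_nonneg _).trans hδ) h1
    (by
      rw [hw.orbitMap_comp_average μ]
      exact (hp.norm_convolution_sub_le hw.toIsContractionFamily μ).trans hδ)
    (T := leftTranslation E) (w := w) (fun h => boundedMeasurable.norm_liftCLM_le _ _ _)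
    (fun h => leftTranslation_mul_of_mul_eq_one (inv_mul_cancel h))
    (fun h => hp.commute_leftTranslation μ h) hw.leftTranslation_comp_orbitMap
    (hw.average_comp_leftTranslation μ)

end IsContractionAntirep

end Convolution

/-! ### Gate sequences -/

section GateSequence

variable {G : Type*}

theorem inversionGate_succ [Group G] {m : ℕ} (g : Fin (m + 1) → G) :
    inversionGate g = (g 0)⁻¹ * inversionGate (Fin.tail g) := by
  simp [inversionGate, List.ofFn_succ, Fin.tail_def]

theorem sequenceOp_succ {d m : ℕ} (φ : G → SuperOp d) (g : Fin (m + 1) → G) :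
    sequenceOp φ g = sequenceOp φ (Fin.tail g) * φ (g 0) := by
  simp [sequenceOp, List.ofFn_succ, Fin.tail_def]

theorem heisenberg_sequenceOp {d m : ℕ} (φ : G → SuperOp d) (g : Fin m → G) :
    heisenberg d (sequenceOp φ g) = (List.ofFn fun j => heisenberg d (φ (g j))).prod := by
  induction m with
  | zero => simp [sequenceOp, heisenberg_one]
  | succ m ih => rw [sequenceOp_succ, heisenberg_mul, ih, List.ofFn_succ, List.prod_cons]; rfl

theorem posSemidef_sequenceOp {d m : ℕ} {φ : G → SuperOp d}
    (hφ : ∀ g, IsCompletelyPositive (φ g)) (g : Fin m → G) {X : Matrix (Fin d) (Fin d) ℂ}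
    (hX : X.PosSemidef) : (sequenceOp φ g X).PosSemidef := by
  induction m generalizing X with
  | zero => simpa [sequenceOp] using hX
  | succ m ih =>
    rw [sequenceOp_succ]
    exact ih (Fin.tail g) ((hφ (g 0)).posSemidef hX)

end GateSequence

/-! ### Iterated convolution as an integral over gate sequences -/

namespace IsContractionFamily

variable {G E : Type*} [MeasurableSpace G] [NormedAddCommGroup E] [NormedSpace ℂ E]
  {p : G → E →L[ℂ] E}

theorem norm_prod_ofFn_apply_le (hp : IsContractionFamily p) {m : ℕ} (g : Fin m → G) (v : E) :
    ‖(List.ofFn fun j => p (g j)).prod v‖ ≤ ‖v‖ := by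
  induction m with
  | zero => simp
  | succ m ih =>
    rw [List.ofFn_succ, List.prod_cons]
    exact (hp.norm_apply_le _ _).trans (ih _)

variable [Group G] [MeasurableMul₂ G] [MeasurableInv G]

theorem stronglyMeasurable_sequence (hp : IsContractionFamily p) (F : boundedMeasurable G E)
    (m : ℕ) : StronglyMeasurable fun q : G × (Fin m → G) =>
      (List.ofFn fun j => p (q.2 j)).prod (F (q.1 * inversionGate q.2)) := by
  induction m with
  | zero =>
    have : StronglyMeasurable fun q : G × (Fin 0 → G) => F q.1 :=
      (boundedMeasurable.stronglyMeasurable F).comp_measurable measurable_fst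
    simpa [inversionGate] using this
  | succ m ih =>
    have h0 : Measurable fun q : G × (Fin (m + 1) → G) => q.2 0 :=
      (measurable_pi_apply 0).comp measurable_snd
    have htail : Measurable fun q : G × (Fin (m + 1) → G) => Fin.tail q.2 :=
      measurable_pi_lambda _ fun j => (measurable_pi_apply j.succ).comp measurable_snd
    have := stronglyMeasurable_clm_apply (hp.stronglyMeasurable.comp_measurable h0)
      (ih.comp_measurable ((measurable_fst.mul h0.inv).prodMk htail))
    convert this using 2 with q
    simp only [List.ofFn_succ, List.prod_cons, inversionGate_succ, Function.comp_apply,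
      Pi.mul_apply, Pi.inv_apply, mul_assoc]
    rfl

/-- Induction peels off the first gate: its Heisenberg map is outermost and its inverse leftmost in
`inversionGate`. Fubini joins its integral to those over the remaining gates. -/
theorem convolution_pow_apply (hp : IsContractionFamily p) [CompleteSpace E] (μ : Measure G)
    [IsProbabilityMeasure μ] (F : boundedMeasurable G E) (m : ℕ) (x : G) :
    (hp.convolution μ ^ m) F x = ∫ g : Fin m → G,
      (List.ofFn fun j => p (g j)).prod (F (x * inversionGate g)) ∂(Measure.pi fun _ => μ) := by
  induction m generalizing x with
  | zero => simp [inversionGate]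
  | succ m ih =>
    have hmeas := (hp.stronglyMeasurable_sequence F (m + 1)).comp_measurable
      (measurable_prodMk_left (x := x))
    have hint : Integrable (fun g : Fin (m + 1) → G =>
        (List.ofFn fun j => p (g j)).prod (F (x * inversionGate g))) (Measure.pi fun _ => μ) :=
      Integrable.of_bound hmeas.aestronglyMeasurable ‖F‖ (Filter.Eventually.of_forall fun g =>
        (hp.norm_prod_ofFn_apply_le g _).trans (boundedMeasurable.norm_apply_le F _))
    have hmp := (measurePreserving_piFinSuccAbove (fun _ : Fin (m + 1) => μ) 0).symm
    have hint' := (hmp.integrable_comp_emb (MeasurableEquiv.measurableEmbedding _)).2 hint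
    rw [pow_succ', mul_apply_eq_comp, convolution_apply, ← hmp.integral_comp']
    refine Eq.trans ?_ (integral_prod _ hint').symm
    refine integral_congr_ae (Filter.Eventually.of_forall fun g => ?_)
    simp only [ih, Function.comp_apply]
    rw [← ContinuousLinearMap.integral_comp_comm]
    · refine integral_congr_ae (Filter.Eventually.of_forall fun g' => ?_)
      have e : (MeasurableEquiv.piFinSuccAbove (fun _ => G) 0).symm (g, g') = Fin.cons g g' := by
        simp [MeasurableEquiv.piFinSuccAbove_symm_apply, Fin.insertNthEquiv]
      simp only [e, inversionGate_succ, List.ofFn_succ, List.prod_cons, Fin.cons_zero,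
        Fin.cons_succ, Fin.tail_cons, mul_assoc]
      rfl
    · refine Integrable.of_bound ((hp.stronglyMeasurable_sequence F m).comp_measurable
        (measurable_prodMk_left (x := x * g⁻¹))).aestronglyMeasurable ‖F‖
        (Filter.Eventually.of_forall fun g' => (hp.norm_prod_ofFn_apply_le g' _).trans
          (boundedMeasurable.norm_apply_le F _))

end IsContractionFamily

/-! ### Measurable families of superoperators -/

section MeasurableFamily

variable {G : Type*} [MeasurableSpace G] {d : ℕ} {φ : G → SuperOp d}

instance : OpensMeasurableSpace (Fin d → Fin d → Fin d → Fin d → ℂ) := by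
  have : BorelSpace (Fin d → Fin d → ℂ) := inferInstance
  have : BorelSpace (Fin d → Fin d → Fin d → ℂ) := inferInstance
  infer_instance

theorem measurable_coeff (hφ : ∀ X i j, Measurable fun g => φ g X i j) :
    Measurable fun g a b i j => φ g (Matrix.single a b 1) i j :=
  measurable_pi_lambda _ fun _ => measurable_pi_lambda _ fun _ => measurable_pi_lambda _ fun _ =>
    measurable_pi_lambda _ fun _ => hφ _ _ _

theorem measurable_diamondNorm (hφ : ∀ X i j, Measurable fun g => φ g X i j) :
    Measurable fun g => diamondNorm (φ g) := by
  have := continuous_diamondNorm_superOpOfCoeff.measurable.comp (measurable_coeff hφ)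
  simpa only [Function.comp_def, superOpOfCoeff_apply_self] using this

theorem stronglyMeasurable_heisenberg (hφ : ∀ X i j, Measurable fun g => φ g X i j) :
    StronglyMeasurable fun g => heisenberg d (φ g) := by
  have hc : Continuous (heisenberg d ∘ₗ superOpOfCoeff d) :=
    LinearMap.continuous_of_finiteDimensional _
  have := hc.comp_stronglyMeasurable (measurable_coeff hφ).stronglyMeasurable
  simpa only [LinearMap.comp_apply, superOpOfCoeff_apply_self] using this

theorem isContractionFamily_heisenberg (hφ : ∀ X i j, Measurable fun g => φ g X i j)
    (hop : ∀ g, IsQuantumOperation (φ g)) : IsContractionFamily fun g => heisenberg d (φ g) :=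
  ⟨stronglyMeasurable_heisenberg hφ, fun g => norm_heisenberg_le_one (hop g)⟩

/-- Gives a uniform bound on the diamond norms of differences of quantum operations, hence
integrability; without it the integral in the hypothesis could default to zero. -/
theorem exists_choiNorm_le (d : ℕ) :
    ∃ c, 0 ≤ c ∧ ∀ C : SuperOp d, choiNorm C ≤ c * ‖heisenberg d C‖ := by
  let f : Fin d → Fin d → StateFunctional d := fun i j => Matrix.entryLinearMap ℂ ℂ i j
  refine ⟨∑ a : Fin d, ∑ b : Fin d, ∑ i, ∑ j, ‖evalAt (Matrix.single a b (1 : ℂ))‖ * ‖f i j‖,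
    by positivity, fun C => ?_⟩
  simp only [choiNorm, Finset.sum_mul]
  refine Finset.sum_le_sum fun a _ => Finset.sum_le_sum fun b _ =>
    Finset.sum_le_sum fun i _ => Finset.sum_le_sum fun j _ => ?_
  change ‖evalAt (Matrix.single a b 1) (heisenberg d C (f i j))‖ ≤ _
  refine (ContinuousLinearMap.le_opNorm _ _).trans ?_
  rw [mul_assoc, mul_comm ‖f i j‖]
  exact mul_le_mul_of_nonneg_left (ContinuousLinearMap.le_opNorm _ _) (norm_nonneg _)

theorem integral_norm_heisenberg_sub_le {ψ : G → SuperOp d} (μ : Measure G)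
    [IsProbabilityMeasure μ] (hφ : ∀ X i j, Measurable fun g => φ g X i j)
    (hψ : ∀ X i j, Measurable fun g => ψ g X i j)
    (hφo : ∀ g, IsQuantumOperation (φ g)) (hψo : ∀ g, IsQuantumOperation (ψ g)) :
    ∫ g, ‖heisenberg d (φ g) - heisenberg d (ψ g)‖ ∂μ ≤ ∫ g, diamondNorm (ψ g - φ g) ∂μ := by
  have hd : ∀ X i j, Measurable fun g => (ψ g - φ g) X i j := fun X i j =>
    (hψ X i j).sub (hφ X i j)
  have hn : ∀ g, ‖heisenberg d (ψ g - φ g)‖ ≤ 2 := fun g => by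
    rw [map_sub]
    exact (norm_sub_le _ _).trans
      (by linarith [norm_heisenberg_le_one (hφo g), norm_heisenberg_le_one (hψo g)])
  refine integral_mono_of_nonneg (Filter.Eventually.of_forall fun _ => norm_nonneg _) ?_
    (Filter.Eventually.of_forall fun g => ?_)
  · obtain ⟨c, hc0, hc⟩ := exists_choiNorm_le d
    refine Integrable.of_bound (measurable_diamondNorm hd).aestronglyMeasurable (c * 2)
      (Filter.Eventually.of_forall fun g => ?_)
    rw [Real.norm_of_nonneg (diamondNorm_nonneg _)]
    exact (diamondNorm_le_choiNorm _).trans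
      ((hc _).trans (mul_le_mul_of_nonneg_left (hn g) hc0))
  · change ‖heisenberg d (φ g) - heisenberg d (ψ g)‖ ≤ _
    rw [norm_sub_rev, ← map_sub]
    refine norm_heisenberg_le_diamondNorm fun χ => ?_
    exact ((hψo g).1.posSemidef (posSemidef_ketBra χ)).1.sub
      ((hφo g).1.posSemidef (posSemidef_ketBra χ)).1

end MeasurableFamily

/-- A right translate of Haar measure is again a Haar probability measure, and there is only one. -/
theorem isMulRightInvariant_of_compactSpace {G : Type*} [Group G] [TopologicalSpace G]
    [IsTopologicalGroup G] [CompactSpace G] [MeasurableSpace G] [BorelSpace G] (μ : Measure G)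
    [μ.IsHaarMeasure] [IsProbabilityMeasure μ] : μ.IsMulRightInvariant where
  map_mul_right_eq_self g := by
    have : IsProbabilityMeasure (Measure.map (· * g) μ) :=
      Measure.isProbabilityMeasure_map (measurable_mul_const g).aemeasurable
    exact Measure.isHaarMeasure_eq_of_isProbabilityMeasure _ _

/-! ### Dualization -/

section Dualization

variable {d : ℕ}

theorem heisenberg_injective : Function.Injective (heisenberg d) := by
  intro C D h
  refine LinearMap.ext fun X => sub_eq_zero.1 ((Module.forall_dual_apply_eq_zero_iff ℂ _).1
    fun f => ?_)
  have := LinearMap.congr_fun (DFunLike.congr_fun h f) X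
  rw [heisenberg_apply, heisenberg_apply] at this
  rw [map_sub, this, sub_self]

/-- Transpose once more and identify the finite-dimensional space with its bidual. -/
theorem heisenberg_surjective : Function.Surjective (heisenberg d) := by
  intro t
  refine ⟨(Module.evalEquiv ℂ (Matrix (Fin d) (Fin d) ℂ)).symm.toLinearMap ∘ₗ
    Module.Dual.transpose t.toLinearMap ∘ₗ
      (Module.evalEquiv ℂ (Matrix (Fin d) (Fin d) ℂ)).toLinearMap, ?_⟩
  refine ContinuousLinearMap.ext fun f => LinearMap.ext fun X => ?_
  rw [heisenberg_apply]
  exact Module.apply_evalEquiv_symm_apply _ _ _ _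

theorem heisenberg_pow (C : SuperOp d) (m : ℕ) : heisenberg d (C ^ m) = heisenberg d C ^ m := by
  induction m with
  | zero => rw [pow_zero, pow_zero, heisenberg_one]
  | succ m ih => rw [pow_succ, heisenberg_mul, ih, pow_succ']

end Dualization

/-- The blocks are built from the exact average distance; monotonicity of the bound transfers the
estimate to every admissible larger `ε`, so the blocks need not depend on it. Here `9/2 ≤ 16 ≤ 16 /
(1 - 9ε)`. -/
theorem riccatiBound_rate_le {δ ε : ℝ} (h0 : 0 ≤ δ) (h : δ ≤ ε) (h1 : ε < 1 / 9) (m : ℕ) :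
    9 / 2 * (δ * (2 + riccatiBound δ)) ^ m
      ≤ 16 / (1 - 9 * ε) * (ε * (2 + 4 * ε / (1 - 5 * ε))) ^ m := by
  have hx0 := riccatiBound_nonneg h0 (h.trans_lt h1)
  have h9 : 0 < 1 - 9 * ε := by linarith
  have hr : riccatiBound δ ≤ 4 * ε / (1 - 5 * ε) := riccatiBound_mono h h1
  refine mul_le_mul ?_ (pow_le_pow_left₀ (by positivity) ?_ m) (by positivity) (by positivity)
  · rw [le_div_iff₀ h9]; linarith
  · exact mul_le_mul h (by linarith) (by linarith) (h0.trans h)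

/-! ### Output probabilities -/

section OutputProb

variable {G : Type*} [MeasurableSpace G] {d : ℕ}

/-- The functional-valued function `x ↦ Tr (E φ(x) ·)` of the ending gate. -/
noncomputable def effectFunction {φ : G → SuperOp d}
    (hφ : IsContractionFamily fun g => heisenberg d (φ g)) (E : Matrix (Fin d) (Fin d) ℂ) :
    boundedMeasurable G (StateFunctional d) :=
  boundedMeasurable.mk (fun x => heisenberg d (φ x) (traceFunctional E))
    (stronglyMeasurable_clm_apply hφ.stronglyMeasurable stronglyMeasurable_const)
    ‖traceFunctional E‖ fun x => hφ.norm_apply_le x _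

theorem norm_effectFunction_le {φ : G → SuperOp d}
    (hφ : IsContractionFamily fun g => heisenberg d (φ g)) (E : Matrix (Fin d) (Fin d) ℂ) :
    ‖effectFunction hφ E‖ ≤ ‖traceFunctional E‖ :=
  boundedMeasurable.norm_le (norm_nonneg _) fun x => hφ.norm_apply_le x _

theorem ofReal_outputProb [Group G] [MeasurableMul₂ G] [MeasurableInv G] {φ : G → SuperOp d}
    (hφ : IsContractionFamily fun g => heisenberg d (φ g))
    (hcp : ∀ g, IsCompletelyPositive (φ g)) (μ : Measure G) [IsProbabilityMeasure μ] (gEnd : G)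
    {ρ E : Matrix (Fin d) (Fin d) ℂ} (hρ : ρ.PosSemidef) (hE : E.PosSemidef) (m : ℕ) :
    (outputProb μ φ gEnd ρ E m : ℂ) =
      evalAt ρ ((hφ.convolution μ ^ m) (effectFunction hφ E) gEnd) := by
  rw [hφ.convolution_pow_apply, outputProb, ← integral_complex_ofReal,
    ← ContinuousLinearMap.integral_comp_comm]
  · refine integral_congr_ae (Filter.Eventually.of_forall fun g => ?_)
    change ((E * φ (gEnd * inversionGate g) (sequenceOp φ g ρ)).trace.re : ℂ) = _
    rw [ofReal_re_trace_mul hE.1 ((hcp _).posSemidef (posSemidef_sequenceOp hcp g hρ)).1]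
    beta_reduce
    rw [← heisenberg_sequenceOp]
    rfl
  · exact Integrable.of_bound ((hφ.stronglyMeasurable_sequence _ m).comp_measurable
      (measurable_prodMk_left (x := gEnd))).aestronglyMeasurable ‖effectFunction hφ E‖
      (Filter.Eventually.of_forall fun g => (hφ.norm_prod_ofFn_apply_le g _).trans
        (boundedMeasurable.norm_apply_le _ _))

theorem norm_evalAt_apply_le {T : boundedMeasurable G (StateFunctional d) →L[ℂ]
      boundedMeasurable G (StateFunctional d)} {c : ℝ} (hT : ‖T‖ ≤ c)
    {F : boundedMeasurable G (StateFunctional d)} (hF : ‖F‖ ≤ 1) {ρ : Matrix (Fin d) (Fin d) ℂ}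
    (hρ : IsState ρ) (g : G) : ‖evalAt ρ (T F g)‖ ≤ c := by
  refine ((T F g).norm_apply_le_of_posSemidef hρ.1).trans ?_
  rw [hρ.2, Complex.one_re, one_mul]
  refine (boundedMeasurable.norm_apply_le _ g).trans ((T.le_opNorm F).trans ?_)
  exact (mul_le_of_le_one_right (norm_nonneg T) hF).trans hT

end OutputProb

/-! ### Application to the reference and noisy implementations -/

theorem isContractionAntirep_heisenberg {G : Type*} [Group G] [MeasurableSpace G] {d : ℕ}
    {r : Representation ℂ G (Matrix (Fin d) (Fin d) ℂ)}
    (hr : ∀ X i j, Measurable fun g => r g X i j) (hop : ∀ g, IsQuantumOperation (r g)) :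
    IsContractionAntirep fun g => heisenberg d (r g) where
  toIsContractionFamily := isContractionFamily_heisenberg hr hop
  map_one := by rw [map_one, heisenberg_one]
  map_mul g h := by rw [map_mul, heisenberg_mul]

/-- The linear form on superoperators obtained by sandwiching the Heisenberg picture. -/
noncomputable def sandwich {d : ℕ} (f : StateFunctional d) (g : StateFunctional d →L[ℂ] ℂ) :
    SuperOp d →ₗ[ℂ] ℂ :=
  g.toLinearMap ∘ₗ (ContinuousLinearMap.apply ℂ (StateFunctional d) f).toLinearMap ∘ₗ heisenberg d

theorem exists_outputProb_approx {G : Type*} [Group G] [MeasurableSpace G] [MeasurableMul₂ G]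
    [MeasurableInv G] (μ : Measure G) [IsProbabilityMeasure μ] [μ.IsMulRightInvariant] {d : ℕ}
    {r : Representation ℂ G (Matrix (Fin d) (Fin d) ℂ)}
    (hr : ∀ X i j, Measurable fun g => r g X i j) (hr_op : ∀ g, IsQuantumOperation (r g))
    {φ : G → SuperOp d} (hφ : ∀ X i j, Measurable fun g => φ g X i j)
    (hφ_op : ∀ g, IsQuantumOperation (φ g)) {δ : ℝ}
    (hδ : ∫ g, diamondNorm (r g - φ g) ∂μ ≤ δ) (h1 : δ < 1 / 9) :
    ∃ t : SuperOp d, (∀ g, t * r g = r g * t) ∧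
      ∀ (gEnd : G) (ρ : Matrix (Fin d) (Fin d) ℂ) (K : ℕ) (P : Fin K → Matrix (Fin d) (Fin d) ℂ),
      IsState ρ → IsPOVM P → ∀ i : Fin K, ∃ f : SuperOp d →ₗ[ℂ] ℂ, ∀ m : ℕ, 0 < m →
        ‖(outputProb μ φ gEnd ρ (P i) m : ℂ) - f (t ^ m)‖
          ≤ 9 / 2 * (δ * (2 + riccatiBound δ)) ^ m := by
  have hp := isContractionFamily_heisenberg hφ hφ_op
  have hw := isContractionAntirep_heisenberg hr hr_op
  obtain ⟨t', S, U, ht', hU⟩ := hw.exists_convolution_pow_approx μ hp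
    ((integral_norm_heisenberg_sub_le μ hφ hr hφ_op hr_op).trans hδ) h1
  obtain ⟨t, rfl⟩ := heisenberg_surjective t'
  refine ⟨t, fun g => heisenberg_injective ?_, fun gEnd ρ K P hρ hP i => ?_⟩
  · rw [heisenberg_mul, heisenberg_mul]
    exact (ht' g).symm
  · refine ⟨sandwich (U (effectFunction hp (P i)))
      (evalAt ρ ∘L boundedMeasurable.eval gEnd ∘L S), fun m hm => ?_⟩
    rw [ofReal_outputProb hp (fun g => (hφ_op g).1) μ gEnd hρ.1 (hP.1 i)]
    refine le_trans (le_of_eq ?_) (norm_evalAt_apply_le (hU m hm)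
      ((norm_effectFunction_le hp (P i)).trans (norm_traceFunctional_le_one hP i)) hρ gEnd)
    rw [← heisenberg_pow]
    rfl

end RandomizedBenchmarking

theorem theorem1
    -- the gate set: a compact Lie group with its normalized Haar measure
    {k : ℕ} {G : Type*} [Group G] [TopologicalSpace G]
    [ChartedSpace (EuclideanSpace ℝ (Fin k)) G] [LieGroup (𝓡 k) ∞ G]
    [CompactSpace G] [T2Space G] [MeasurableSpace G] [BorelSpace G]
    (μ : Measure G) [μ.IsHaarMeasure] [IsProbabilityMeasure μ]
    -- the reference representation, acting by quantum channels on a finite-dimensional system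
    {d : ℕ} (refRep : Representation ℂ G (Matrix (Fin d) (Fin d) ℂ))
    (href_cont : ∀ X, Continuous fun g => refRep g X)
    (href_channel : ∀ g, RandomizedBenchmarking.IsQuantumChannel (refRep g))
    -- its decomposition into pairwise inequivalent irreducibles `σ l` with multiplicities `n l`
    {L : Type*} [Fintype L] (V : L → Type*) [∀ l, AddCommGroup (V l)] [∀ l, Module ℂ (V l)]
    (σ : ∀ l, Representation ℂ G (V l)) (hσ_irr : ∀ l, (σ l).IsIrreducible)
    (hσ_ineq : ∀ l l', l ≠ l' → IsEmpty ((σ l).Equiv (σ l')))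
    (n : L → ℕ)
    (e : refRep.Equiv (Representation.directSum fun p : (l : L) × Fin (n l) => σ p.1))
    -- the noisy implementation
    (φ : G → RandomizedBenchmarking.SuperOp d)
    (hφ_op : ∀ g, RandomizedBenchmarking.IsQuantumOperation (φ g))
    (hφ_meas : ∀ X i j, Measurable fun g => φ g X i j) :
    ∃ M : ∀ l, Matrix (Fin (n l)) (Fin (n l)) ℂ,
      ∀ δ : ℝ, 0 < δ → ∫ g, RandomizedBenchmarking.diamondNorm (refRep g - φ g) ∂μ ≤ δ → δ < 1 / 9 →
      ∀ (gEnd : G) (ρ : Matrix (Fin d) (Fin d) ℂ) (K : ℕ) (P : Fin K → Matrix (Fin d) (Fin d) ℂ),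
      RandomizedBenchmarking.IsState ρ → RandomizedBenchmarking.IsPOVM P →
      ∀ i : Fin K, ∃ A : ∀ l, Matrix (Fin (n l)) (Fin (n l)) ℂ,
      ∀ m : ℕ, 0 < m →
        ‖(RandomizedBenchmarking.outputProb μ φ gEnd ρ (P i) m : ℂ)
            - ∑ l, (A l * M l ^ m).trace‖
          ≤ 16 / (1 - 9 * δ) * (δ * (2 + 4 * δ / (1 - 5 * δ))) ^ m := by
  classical
  have hG : IsTopologicalGroup G := topologicalGroup_of_lieGroup (𝓡 k) ∞
  -- Second countability makes multiplication jointly measurable for the Borel structure, as Fubini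
  -- and the convolution require.
  have hG2 : SecondCountableTopology G :=
    ChartedSpace.secondCountable_of_sigmaCompact (EuclideanSpace ℝ (Fin k)) G
  have := RandomizedBenchmarking.isMulRightInvariant_of_compactSpace μ
  by_cases h : ∫ g, RandomizedBenchmarking.diamondNorm (refRep g - φ g) ∂μ < 1 / 9
  · obtain ⟨t, ht, hf⟩ := RandomizedBenchmarking.exists_outputProb_approx μ (r := refRep)
      (fun X i j => ((href_cont X).matrix_elem i j).measurable)
      (fun g => (href_channel g).isQuantumOperation) hφ_meas hφ_op le_rfl h
    obtain ⟨M, hM⟩ := RandomizedBenchmarking.exists_matrix_powers_of_commute e hσ_irr hσ_ineq t ht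
    refine ⟨M, fun δ _ hδ hδ9 gEnd ρ K P hρ hP i => ?_⟩
    obtain ⟨f, hf⟩ := hf gEnd ρ K P hρ hP i
    obtain ⟨A, hA⟩ := hM f
    refine ⟨A, fun m hm => ?_⟩
    rw [← hA]
    exact (hf m hm).trans (RandomizedBenchmarking.riccatiBound_rate_le
      (integral_nonneg fun _ => RandomizedBenchmarking.diamondNorm_nonneg _) hδ hδ9 m)
  -- If the average distance is at least `1/9`, no admissible `δ` exists and any blocks do.
  · exact ⟨0, fun δ _ hδ hδ9 => absurd (hδ.trans_lt hδ9) h⟩
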